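/- Let $0<r<1/2$, $0<2\omega<1-2r$ and $s=\frac{r}{2-4r-2\omega}$. All limits and the relations $\asymp$, $o$ are taken as $\varepsilon\to0+$. In the Gaussian white noise model $dY_\varepsilon(t)=S(t)\,dt+\varepsilon\,dw(t)$, $t\in(0,1)$, $S\in L_2(0,1)$, let $(\phi_j)_{j\ge1}$ be an orthonormal system in $L_2(0,1)$, and observe $y_{\varepsilon j}=\theta_j+\varepsilon\xi_j$, where $\theta_j=\int_0^1S\phi_j\,dt$ and the $\xi_j$ are i.i.d. $N(0,1)$. For each $\varepsilon>0$ let $(\varkappa_{\varepsilon j}^2)_{j\ge1}$ be nonnegative weights with finite sum $\rho_\varepsilon^2=\sum_j\varkappa_{\varepsilon j}^2$, and put $A_\varepsilon=\varepsilon^{-4}\sum_j\varkappa_{\varepsilon j}^4$, $k_\varepsilon=\sup\{k:\sum_{j<k}\varkappa_{\varepsilon j}^2\le\frac12\rho_\varepsilon^2\}$, $\varkappa_\varepsilon^2=\varkappa_{\varepsilon k_\varepsilon}^2$. Let $k_\varepsilon\asymp\varepsilon^{-4+8r+4\omega}$ and assume A1. For each $\varepsilon>0$ the sequence $j\mapsto\varkappa_{\varepsilon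 j}^2$ is non-increasing. A2. There are constants $0<C_1<C_2$ with $C_1<A_\varepsilon<C_2$ for all $\varepsilon>0$. A3. There are $C_1>0$ and $\lambda>1$ such that $\varkappa^2_{\varepsilon,[(1+d)k_\varepsilon]}<C_1(1+d)^{-\lambda}\varkappa_\varepsilon^2$ for all $d>0$, $\varepsilon>0$. A4. $\varkappa_{\varepsilon1}^2\asymp\varkappa_\varepsilon^2$, and for every $c_0>1$ there is $C>0$ with $\varkappa^2_{\varepsilon,[c_0k_\varepsilon]}\ge C\varkappa_\varepsilon^2$ for all $\varepsilon>0$. Let $T_\varepsilon=\varepsilon^{-2}\sum_j\varkappa_{\varepsilon j}^2y_{\varepsilon j}^2-\rho_\varepsilon^2$. For a family of thresholds $x_\varepsilon\in\mathbb R$ let $L_\varepsilon=\mathbf 1\{\varepsilon^{-2}(2A_\varepsilon)^{-1/2}T_\varepsilon>x_\varepsilon\}$, with type I error $\alpha(L_\varepsilon)=\mathbf E_0L_\varepsilon$ and type II error $\beta(L_\varepsilon,S)=\mathbf E_S(1-L_\varepsilon)$. Put $D_\varepsilon(S)=\varepsilon^{-4}\sum_j\varkappa_{\varepsilon j}^2\theta_j^2$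 and $B_\varepsilon(S)=D_\varepsilon(S)/(2A_\varepsilon)^{1/2}$. A family $S_\varepsilon$ is called $\varepsilon^{-2\omega}$-LD consistent if, for every family of such tests with $\varepsilon^{4\omega}\log\alpha(L_\varepsilon)\to0$, there is $C>0$ with $|\log\beta(L_\varepsilon,S_\varepsilon)|\ge C\varepsilon^{-4\omega}$ for all sufficiently small $\varepsilon$ (where $|\log0|=\infty$). For $P_0>0$ put $$\bar{\mathbb B}^s_{2\infty}(P_0)=\Bigl\{S=\sum_j\theta_j\phi_j:\ \sup_{t>0}t^{2s}\sum_{j>t}\theta_j^2\le P_0\Bigr\}.$$ **Theorem.** Let $\delta>0$, $c>0$, and let $S_\varepsilon\in L_2(0,1)$ be an $\varepsilon^{-2\omega}$-LD consistent family with $\|S_\varepsilon\|\asymp\varepsilon^{2r}$. Then there are $P_0>0$ and functions $S_{1\varepsilon}\in\bar{\mathbb B}^s_{2\infty}(P_0)$, $\varepsilon>0$, with $\|S_{1\varepsilon}\|\asymp\varepsilon^{2r}$ and with $S_{1\varepsilon}$ orthogonal to $S_\varepsilon-S_{1\varepsilon}$ for all $\varepsilon>0$, such that the following holds. For every family of tests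 $L_\varepsilon$ of the above form with $\alpha(L_\varepsilon)\to0$ and $$D_\varepsilon(S_\varepsilon)\to\infty,\qquad D_\varepsilon(S_\varepsilon)=o(k_\varepsilon^{1/2}),\qquad B_\varepsilon(S_\varepsilon)-x_\varepsilon\ge c\,B_\varepsilon(S_\varepsilon)\ \text{ for all sufficiently small }\varepsilon,$$ there is $\varepsilon_0>0$ such that for all $0<\varepsilon<\varepsilon_0$ $$|\log\beta(L_\varepsilon,S_\varepsilon)-\log\beta(L_\varepsilon,S_{1\varepsilon})|\le\delta\,|\log\beta(L_\varepsilon,S_\varepsilon)|,$$ $$|\log\beta(L_\varepsilon,S_\varepsilon-S_{1\varepsilon})|\le\delta\,|\log\beta(L_\varepsilon,S_\varepsilon)|.$$ -/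

import Mathlib

open MeasureTheory ProbabilityTheory Filter Topology Asymptotics
open scoped ENNReal NNReal

noncomputable section

namespace QuadTest

/-- The real Hilbert space `L₂(0,1)`. -/
abbrev L2 : Type := Lp ℝ 2 (volume.restrict (Set.Ioo (0 : ℝ) 1))

/-- The `j`-th Fourier coefficient `θ_j = ∫₀¹ S φ_j dt`. -/
def coeff (φ : ℕ+ → L2) (S : L2) (j : ℕ+) : ℝ := inner ℝ (φ j) S

/-- The set of all `S = ∑ θ_j φ_j` with `sup_{t > 0} t^{2s} ∑_{j > t} θ_j² ≤ P₀`. -/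
def besovBall (φ : ℕ+ → L2) (s P₀ : ℝ) : Set L2 :=
  {S | ∃ θ : ℕ+ → ℝ, HasSum (fun j => θ j • φ j) S ∧
    ∀ t : ℝ, 0 < t → t ^ (2 * s) * (∑' j : ℕ+, if t < (j : ℝ) then θ j ^ 2 else 0) ≤ P₀}

/-! Weights: `κ ε j`, `j ≥ 1`, is the `j`-th coefficient at noise level `ε`; it enters only
through its square, and the value at `j = 0` is never used. -/

/-- `ρ_ε² = ∑_{j ≥ 1} κ_{εj}²`. -/
def rhoSq (κ : ℝ → ℕ → ℝ) (ε : ℝ) : ℝ := ∑' j : ℕ+, κ ε j ^ 2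

/-- `A_ε = ε⁻⁴ ∑_{j ≥ 1} κ_{εj}⁴`. -/
def A (κ : ℝ → ℕ → ℝ) (ε : ℝ) : ℝ := (ε ^ 4)⁻¹ * ∑' j : ℕ+, κ ε j ^ 4

/-- `k_ε = sup {k : ∑_{1 ≤ j < k} κ_{εj}² ≤ ρ_ε² / 2}`. -/
def kEff (κ : ℝ → ℕ → ℝ) (ε : ℝ) : ℕ :=
  sSup {k : ℕ | ∑ j ∈ Finset.Ico 1 k, κ ε j ^ 2 ≤ rhoSq κ ε / 2}

/-- `κ_ε² = κ_{ε k_ε}²`. -/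
def kappaSq (κ : ℝ → ℕ → ℝ) (ε : ℝ) : ℝ := κ ε (kEff κ ε) ^ 2

/-- The weights `κ_{εj}²` have a finite sum, so that the test statistic makes sense. -/
def WeightsSummable (κ : ℝ → ℕ → ℝ) : Prop :=
  ∀ ε : ℝ, 0 < ε → Summable (fun j : ℕ+ => κ ε j ^ 2)

def CondA1 (κ : ℝ → ℕ → ℝ) : Prop :=
  ∀ ε : ℝ, 0 < ε → AntitoneOn (fun j : ℕ => κ ε j ^ 2) (Set.Ici 1)

def CondA2 (κ : ℝ → ℕ → ℝ) : Prop :=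
  ∃ C₁ C₂ : ℝ, 0 < C₁ ∧ ∀ ε : ℝ, 0 < ε → C₁ < A κ ε ∧ A κ ε < C₂

def CondA3 (κ : ℝ → ℕ → ℝ) : Prop :=
  ∃ C₁ l : ℝ, 0 < C₁ ∧ 1 < l ∧ ∀ d : ℝ, 0 < d → ∀ ε : ℝ, 0 < ε →
    κ ε ⌊(1 + d) * (kEff κ ε : ℝ)⌋₊ ^ 2 < C₁ * (1 + d) ^ (-l) * kappaSq κ ε

def CondA4 (κ : ℝ → ℕ → ℝ) : Prop :=
  ((fun ε => κ ε 1 ^ 2) =Θ[𝓝[>] (0 : ℝ)] fun ε => kappaSq κ ε) ∧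
  ∀ c : ℝ, 1 < c → ∃ C : ℝ, 0 < C ∧ ∀ ε : ℝ, 0 < ε →
    C * kappaSq κ ε ≤ κ ε ⌊c * (kEff κ ε : ℝ)⌋₊ ^ 2

/-- `D_ε(S) = ε⁻⁴ ∑ κ_{εj}² θ_j²`. -/
def D (φ : ℕ+ → L2) (κ : ℝ → ℕ → ℝ) (ε : ℝ) (S : L2) : ℝ :=
  (ε ^ 4)⁻¹ * ∑' j : ℕ+, κ ε j ^ 2 * coeff φ S j ^ 2

/-- `B_ε(S) = D_ε(S) / (2 A_ε)^{1/2}`. -/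
def B (φ : ℕ+ → L2) (κ : ℝ → ℕ → ℝ) (ε : ℝ) (S : L2) : ℝ :=
  D φ κ ε S / √(2 * A κ ε)

/-- The law of the noise `(ξ_j)`: independent standard normal coordinates. -/
def noise : Measure (ℕ+ → ℝ) := Measure.infinitePi fun _ => gaussianReal 0 1

/-- The observation `y_{εj} = θ_j + ε ξ_j` of the signal `S`. -/
def obs (φ : ℕ+ → L2) (ε : ℝ) (S : L2) (ξ : ℕ+ → ℝ) (j : ℕ+) : ℝ := coeff φ S j + ε * ξ j

/-- The test statistic `T_ε = ε⁻² ∑ κ_{εj}² y_j² - ρ_ε²`. -/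
def T (κ : ℝ → ℕ → ℝ) (ε : ℝ) (y : ℕ+ → ℝ) : ℝ :=
  (ε ^ 2)⁻¹ * (∑' j : ℕ+, κ ε j ^ 2 * y j ^ 2) - rhoSq κ ε

/-- The rejection region of the test `L_ε = 1{ε⁻² (2 A_ε)^{-1/2} T_ε > x}`
(under the hypothesis `ε⁻² (2 A_ε)^{-1/2} T_ε` has mean `0` and variance `1`). -/
def rejectRegion (κ : ℝ → ℕ → ℝ) (ε x : ℝ) : Set (ℕ+ → ℝ) :=
  {y | x < (ε ^ 2)⁻¹ * T κ ε y / √(2 * A κ ε)}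

/-- Type I error probability `α(L_ε)` of the test with threshold `x`. -/
def typeI (φ : ℕ+ → L2) (κ : ℝ → ℕ → ℝ) (ε x : ℝ) : ℝ≥0∞ :=
  noise {ξ | obs φ ε 0 ξ ∈ rejectRegion κ ε x}

/-- Type II error probability `β(L_ε, S)` of the test with threshold `x`. -/
def typeII (φ : ℕ+ → L2) (κ : ℝ → ℕ → ℝ) (ε x : ℝ) (S : L2) : ℝ≥0∞ :=
  noise {ξ | obs φ ε S ξ ∉ rejectRegion κ ε x}

/-- `|log p|`, with the value `∞` at `p = 0`. -/
def absLog (p : ℝ≥0∞) : ℝ≥0∞ := (ENNReal.log p).abs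

/-- `R_ε`-LD consistency of the family `S_ε`: for every choice of thresholds `x_ε` with
`R_ε⁻² log α(L_ε) → 0` one has `|log β(L_ε, S_ε)| = Ω(R_ε²)` as `ε → 0`. -/
def IsLDConsistent (φ : ℕ+ → L2) (κ : ℝ → ℕ → ℝ) (R : ℝ → ℝ) (S : ℝ → L2) : Prop :=
  ∀ x : ℝ → ℝ,
    Tendsto (fun ε => absLog (typeI φ κ ε (x ε)) / ENNReal.ofReal (R ε ^ 2)) (𝓝[>] 0) (𝓝 0) →
    ∃ c : ℝ, 0 < c ∧ ∀ᶠ ε in 𝓝[>] (0 : ℝ),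
      ENNReal.ofReal (c * R ε ^ 2) ≤ absLog (typeII φ κ ε (x ε) (S ε))

/-- Admissible thresholds `x_ε` for the family `S_ε`: the type I error tends to zero,
`D_ε(S_ε) → ∞`, `D_ε(S_ε) = o(k_ε^{1/2})` and `B_ε(S_ε) - x_ε = Ω(B_ε(S_ε))` with the
constant `c` in the last relation. -/
def AdmissibleTests (φ : ℕ+ → L2) (κ : ℝ → ℕ → ℝ) (c : ℝ) (S : ℝ → L2) (x : ℝ → ℝ) : Prop :=
  Tendsto (fun ε => typeI φ κ ε (x ε)) (𝓝[>] 0) (𝓝 0) ∧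
  Tendsto (fun ε => D φ κ ε (S ε)) (𝓝[>] 0) atTop ∧
  ((fun ε => D φ κ ε (S ε)) =o[𝓝[>] (0 : ℝ)] fun ε => √(kEff κ ε : ℝ)) ∧
  ∀ᶠ ε in 𝓝[>] (0 : ℝ), c * B φ κ ε (S ε) ≤ B φ κ ε (S ε) - x ε

end QuadTest

end

namespace QuadTest

/-! After normalisation the test statistic is a quadratic form in shifted Gaussians minus a
constant, with weights `w_j` satisfying `∑ w_j² = 1/2`. Accepting means that the form falls below
its mean by at least `B - x` (`typeII_eq`). If `m` bounds the weights and both `m * B` and `m * (B -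
x)` are small, the form is nearly Gaussian on the logarithmic scale: `log β` is close to `-(B - x)²
/ 2`. This follows from explicit cumulant bounds, by Chernoff in one direction (`typeII_toReal_le`)
and by exponential tilting in the other (`exp_neg_le_typeII_toReal`).

So type II errors depend on the signal essentially only through `B`, which is additive over disjoint
sets of coordinates. Take for `S₁` the Fourier truncation of `S` at `[(1 + d) k_ε]`. With `e = 2 -
4r - 2ω` one has `k_ε ≍ ε^(-2e)` and all weights are `O(ε^e)`. By A3 the remainder has `B` at most a
constant times `(1 + d)^(-l) ε^(-2ω)`, while LD consistency forces `B(S) ≥ b ε^(-2ω)`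
(`eventually_le_B_of_isLDConsistent`). For large `d` the remainder is thus a small fraction of
`B(S)`, and both comparisons follow (`typeII_comparison`).

The truncation lies in a Besov ball because `k_ε^(2s) ‖S‖²` stays bounded exactly when `s = r / e`.
Its norm has the right order because its `B` is still at least of order `ε^(-2ω)`. -/

instance : IsProbabilityMeasure noise := by unfold noise; infer_instance

theorem measurePreserving_eval_noise (j : ℕ+) :
    MeasurePreserving (fun ξ : ℕ+ → ℝ => ξ j) noise (gaussianReal 0 1) :=
  measurePreserving_eval_infinitePi (fun _ : ℕ+ => gaussianReal 0 1) j

/-! ### Laplace transform of a weighted sum of squares of shifted Gaussians. -/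

theorem sub_sq_div_two_le_log_one_add {u : ℝ} (hu : 0 ≤ u) : u - u ^ 2 / 2 ≤ Real.log (1 + u) := by
  refine le_trans ?_ (Real.le_log_one_add_of_nonneg hu)
  rw [le_div_iff₀ (by linarith)]
  nlinarith [pow_nonneg hu 3]

theorem log_one_add_le_cubic {u : ℝ} (hu : 0 ≤ u) :
    Real.log (1 + u) ≤ u - u ^ 2 / 2 + u ^ 3 / 3 := by
  have hd : ∀ x : ℝ, 0 ≤ x → HasDerivAt
      (fun x : ℝ => x - x ^ 2 / 2 + x ^ 3 / 3 - Real.log (1 + x))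
      (x ^ 3 / (1 + x)) x := by
    intro x hx
    have h1 : HasDerivAt (fun x : ℝ => Real.log (1 + x)) (1 / (1 + x)) x :=
      ((hasDerivAt_id x).const_add 1).log (by simp; linarith)
    have h2 := (((hasDerivAt_id x).sub ((hasDerivAt_pow 2 x).div_const 2)).add
      ((hasDerivAt_pow 3 x).div_const 3)).sub h1
    refine h2.congr_deriv ?_
    have : (1 + x) ≠ 0 := by linarith
    field_simp
    push_cast
    ring
  have hm : MonotoneOn (fun x : ℝ => x - x ^ 2 / 2 + x ^ 3 / 3 - Real.log (1 + x)) (Set.Ici 0) := by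
    apply monotoneOn_of_deriv_nonneg (convex_Ici 0)
    · exact fun x hx => (hd x hx).continuousAt.continuousWithinAt
    · exact fun x hx => (hd x (interior_subset hx)).differentiableAt.differentiableWithinAt
    · intro x hx
      have hx0 : 0 ≤ x := interior_subset hx
      rw [(hd x hx0).deriv]
      positivity
  have := hm (Set.mem_Ici.2 le_rfl) (Set.mem_Ici.2 hu) hu
  simp only at this
  norm_num at this
  linarith

theorem integral_exp_neg_mul_sq_gaussianReal {b : ℝ} (hb : 0 ≤ b) (a : ℝ) :
    ∫ x, Real.exp (-(b * (a + x) ^ 2)) ∂(gaussianReal 0 1) =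
      Real.exp (-(Real.log (1 + 2 * b) / 2 + b * a ^ 2 / (1 + 2 * b))) := by
  have hb' : 0 < 1 + 2 * b := by linarith
  rw [integral_gaussianReal_eq_integral_smul one_ne_zero]
  have h1 : ∀ x : ℝ, gaussianPDFReal 0 1 x • Real.exp (-(b * (a + x) ^ 2)) =
      ((√(2 * Real.pi))⁻¹ * Real.exp (-(b * a ^ 2 / (1 + 2 * b)))) *
        Real.exp (-(1 / 2 + b) * (x + 2 * b * a / (1 + 2 * b)) ^ 2) := by
    intro x
    rw [gaussianPDFReal, smul_eq_mul, mul_assoc _ (Real.exp _), mul_assoc _ (Real.exp _),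
      ← Real.exp_add, ← Real.exp_add]
    simp only [NNReal.coe_one, mul_one, sub_zero]
    congr 2
    field_simp
    ring
  simp_rw [h1]
  rw [integral_const_mul,
    integral_add_right_eq_self (fun x : ℝ => Real.exp (-(1 / 2 + b) * x ^ 2)), integral_gaussian,
    neg_add, Real.exp_add]
  have h2 : Real.pi / (1 / 2 + b) = 2 * Real.pi / (1 + 2 * b) := by
    field_simp
  have h3 : Real.exp (-(Real.log (1 + 2 * b) / 2)) = (√(1 + 2 * b))⁻¹ := by
    rw [Real.exp_neg, ← Real.log_sqrt hb'.le, Real.exp_log (Real.sqrt_pos.2 hb')]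
  have h4 : √(2 * Real.pi) ≠ 0 := (Real.sqrt_pos.2 (by positivity)).ne'
  rw [h2, h3, Real.sqrt_div (by positivity)]
  field_simp

/-- The quadratic form `∑ w_j (a_j + ξ_j)²`. -/
noncomputable def quadForm (w a ξ : ℕ+ → ℝ) : ℝ := ∑' j, w j * (a j + ξ j) ^ 2

section QuadForm

variable {w a : ℕ+ → ℝ}

theorem measurable_quadForm (hw : ∀ j, 0 ≤ w j) : Measurable (quadForm w a) := by
  have h : quadForm w a = fun ξ => (∑' j, ENNReal.ofReal (w j * (a j + ξ j) ^ 2)).toReal := by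
    ext ξ
    -- The identity holds for every `ξ`: where the series diverges, both sides take the default
    -- value `0`.
    rw [ENNReal.tsum_toReal_eq (fun _ => ENNReal.ofReal_ne_top)]
    refine tsum_congr fun j => ?_
    rw [ENNReal.toReal_ofReal (mul_nonneg (hw j) (sq_nonneg _))]
  rw [h]
  fun_prop

theorem quadForm_nonneg (hw : ∀ j, 0 ≤ w j) (ξ : ℕ+ → ℝ) : 0 ≤ quadForm w a ξ :=
  tsum_nonneg fun j => mul_nonneg (hw j) (sq_nonneg _)

theorem ae_summable_mul_sq (hw : ∀ j, 0 ≤ w j) (hs : Summable w) :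
    ∀ᵐ ξ ∂noise, Summable fun j => w j * ξ j ^ 2 := by
  set K : ℝ≥0∞ := ∫⁻ x, ENNReal.ofReal (x ^ 2) ∂(gaussianReal 0 1)
  have hK : K ≠ ∞ := by
    have h := (memLp_id_gaussianReal (μ := 0) (v := 1) 2).integrable_sq
    exact (h.lintegral_lt_top).ne
  have h1 : ∀ j, ∫⁻ ξ, ENNReal.ofReal (w j * ξ j ^ 2) ∂noise = ENNReal.ofReal (w j) * K := by
    intro j
    simp_rw [ENNReal.ofReal_mul (hw j)]
    rw [lintegral_const_mul _ (by fun_prop)]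
    congr 1
    exact (measurePreserving_eval_noise j).lintegral_comp
      (f := fun x => ENNReal.ofReal (x ^ 2)) (by fun_prop)
  have h2 : ∫⁻ ξ, ∑' j, ENNReal.ofReal (w j * ξ j ^ 2) ∂noise ≠ ∞ := by
    rw [lintegral_tsum (fun j => (by fun_prop : Measurable _).aemeasurable)]
    simp_rw [h1]
    rw [ENNReal.tsum_mul_right]
    exact ENNReal.mul_ne_top hs.tsum_ofReal_ne_top hK
  filter_upwards [ae_lt_top (by fun_prop) h2] with ξ hξ
  refine (ENNReal.summable_toReal hξ.ne).congr fun j => ?_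
  rw [ENNReal.toReal_ofReal (mul_nonneg (hw j) (sq_nonneg _))]

theorem ae_summable_quadForm (hw : ∀ j, 0 ≤ w j) (hs : Summable w)
    (ha : Summable fun j => w j * a j ^ 2) :
    ∀ᵐ ξ ∂noise, Summable fun j => w j * (a j + ξ j) ^ 2 := by
  filter_upwards [ae_summable_mul_sq hw hs] with ξ hξ
  refine Summable.of_nonneg_of_le (fun j => mul_nonneg (hw j) (sq_nonneg _)) (fun j => ?_)
    ((ha.add hξ).mul_left 2)
  nlinarith [mul_nonneg (hw j) (sq_nonneg (a j - ξ j))]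

theorem integral_exp_neg_finset_quadForm (hw : ∀ j, 0 ≤ w j) {t : ℝ} (ht : 0 ≤ t)
    (F : Finset ℕ+) :
    ∫ ξ, Real.exp (-(t * ∑ j ∈ F, w j * (a j + ξ j) ^ 2)) ∂noise =
      Real.exp (-∑ j ∈ F, (Real.log (1 + 2 * (t * w j)) / 2 +
        t * w j * a j ^ 2 / (1 + 2 * (t * w j)))) := by
  have hind : iIndepFun (fun (j : ℕ+) (ξ : ℕ+ → ℝ) => ξ j) noise :=
    iIndepFun_infinitePi (X := fun _ x => x) (by fun_prop)
  have h := (hind.precomp (g := ((↑) : F → ℕ+)) Subtype.val_injective).integral_fun_prod_comp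
    (f := fun (j : F) (x : ℝ) => Real.exp (-(t * w j * (a j + x) ^ 2)))
    (fun j => (measurable_pi_apply _).aemeasurable)
    (fun j => (by fun_prop : Measurable _).aestronglyMeasurable)
  have h1 : ∀ j : ℕ+, ∫ ξ : ℕ+ → ℝ, Real.exp (-(t * w j * (a j + ξ j) ^ 2)) ∂noise =
      Real.exp (-(Real.log (1 + 2 * (t * w j)) / 2 +
        t * w j * a j ^ 2 / (1 + 2 * (t * w j)))) := by
    intro j
    rw [← integral_exp_neg_mul_sq_gaussianReal (mul_nonneg ht (hw j)),
      ← (measurePreserving_eval_noise j).map_eq,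
      integral_map (measurable_pi_apply j).aemeasurable]
    exact (by fun_prop : Measurable _).aestronglyMeasurable
  simp only [h1, ← Real.exp_sum] at h
  rw [← Finset.sum_neg_distrib, ← Finset.sum_coe_sort F, ← h]
  congr 1
  ext ξ
  congr 1
  rw [Finset.mul_sum, ← Finset.sum_neg_distrib, ← Finset.sum_coe_sort F]
  exact Finset.sum_congr rfl fun j _ => by simp; ring

theorem summable_log_one_add (hw : ∀ j, 0 ≤ w j) (hs : Summable w) {t : ℝ} (ht : 0 ≤ t) :
    Summable fun j => Real.log (1 + 2 * (t * w j)) / 2 := by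
  refine Summable.of_nonneg_of_le (fun j => ?_) (fun j => ?_) (hs.mul_left t)
  · have := mul_nonneg ht (hw j)
    exact div_nonneg (Real.log_nonneg (by linarith)) zero_le_two
  · have := mul_nonneg ht (hw j)
    have := Real.log_le_sub_one_of_pos (show 0 < 1 + 2 * (t * w j) by linarith)
    linarith

theorem summable_shift_term (hw : ∀ j, 0 ≤ w j) (ha : Summable fun j => w j * a j ^ 2)
    {t : ℝ} (ht : 0 ≤ t) :
    Summable fun j => t * w j * a j ^ 2 / (1 + 2 * (t * w j)) := by
  refine Summable.of_nonneg_of_le (fun j => ?_) (fun j => ?_) (ha.mul_left t)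
  · have := hw j
    positivity
  · have := mul_nonneg ht (hw j)
    have h2 := mul_nonneg this (sq_nonneg (a j))
    rw [div_le_iff₀ (by linarith)]
    nlinarith

/-- Passage to the limit from finite sums by dominated convergence: the integrands lie in `[0, 1]`
because the form is nonnegative and `t ≥ 0`. -/
theorem integral_exp_neg_quadForm (hw : ∀ j, 0 ≤ w j) (hs : Summable w)
    (ha : Summable fun j => w j * a j ^ 2) {t : ℝ} (ht : 0 ≤ t) :
    ∫ ξ, Real.exp (-(t * quadForm w a ξ)) ∂noise =
      Real.exp (-∑' j, (Real.log (1 + 2 * (t * w j)) / 2 +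
        t * w j * a j ^ 2 / (1 + 2 * (t * w j)))) := by
  have h1 : Tendsto (fun F : Finset ℕ+ =>
      ∫ ξ, Real.exp (-(t * ∑ j ∈ F, w j * (a j + ξ j) ^ 2)) ∂noise) atTop
      (𝓝 (∫ ξ, Real.exp (-(t * quadForm w a ξ)) ∂noise)) := by
    refine tendsto_integral_filter_of_dominated_convergence (fun _ => 1)
      (Eventually.of_forall fun F => (by fun_prop : Measurable _).aestronglyMeasurable)
      (Eventually.of_forall fun F => ae_of_all _ fun ξ => ?_) (integrable_const _) ?_
    · rw [Real.norm_eq_abs, Real.abs_exp, Real.exp_le_one_iff, neg_nonpos]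
      exact mul_nonneg ht (Finset.sum_nonneg fun j _ => mul_nonneg (hw j) (sq_nonneg _))
    · filter_upwards [ae_summable_quadForm hw hs ha] with ξ hξ
      exact (Real.continuous_exp.tendsto _).comp ((hξ.hasSum.const_mul t).neg)
  simp_rw [integral_exp_neg_finset_quadForm hw ht] at h1
  refine tendsto_nhds_unique h1 ((Real.continuous_exp.tendsto _).comp (Tendsto.neg ?_))
  exact ((summable_log_one_add hw hs ht).add (summable_shift_term hw ha ht)).hasSum

end QuadForm

/-! ### Lower bound for a tail probability from nearly Gaussian exponential moments. -/

/-- Tilting by `(1 + τ) y` concentrates the mass of `X` on `[y, (1 + 2τ) y]`: the parts below and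
above carry at most a quarter each of the exponential moment. On the window itself the exponential
is at most `exp ((1 + τ)(1 + 2τ) y²)`, which bounds the probability from below. For an exact
Gaussian each outer part loses a factor `exp (-τ² y² / 2)`. The relative errors `τ² / 26` cost at
most `(2² + 3²) τ² y² / 52 = τ² y² / 4`, so a loss of `τ² y² / 4 ≥ 2` remains, and `exp (-2) ≤ 1 /
4`. -/
theorem exp_neg_le_measureReal_of_mgf_bounds {Ω : Type*} [MeasurableSpace Ω] {μ : Measure Ω}
    [IsProbabilityMeasure μ] {X : Ω → ℝ} (hX : Measurable X) {τ y : ℝ} (hτ : 0 < τ) (hτ1 : τ ≤ 1)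
    (hy : 0 < y) (hyτ : 8 ≤ (y * τ) ^ 2)
    (hint : ∀ t, 0 ≤ t → Integrable (fun ω => Real.exp (t * X ω)) μ)
    (hub : ∀ t, 0 ≤ t → ∫ ω, Real.exp (t * X ω) ∂μ ≤ Real.exp (t ^ 2 / 2 * (1 + τ ^ 2 / 26)))
    (hlb : Real.exp (((1 + τ) * y) ^ 2 / 2 * (1 - τ ^ 2 / 26)) ≤
      ∫ ω, Real.exp ((1 + τ) * y * X ω) ∂μ) :
    Real.exp (-(y ^ 2 * (1 / 2 + 5 * τ))) ≤ μ.real {ω | y ≤ X ω} := by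
  set L := ((1 + τ) * y) ^ 2 / 2 * (1 - τ ^ 2 / 26) with hL
  have hmeas : MeasurableSet {ω | y ≤ X ω} := measurableSet_le measurable_const hX
  have hy2 : 0 < y ^ 2 := by positivity
  have hτy : 8 ≤ τ ^ 2 * y ^ 2 := by nlinarith
  have hτ2 : τ ^ 2 ≤ τ := by nlinarith
  have he : Real.exp (-2) ≤ 1 / 4 := by
    rw [Real.exp_neg, one_div]
    refine inv_anti₀ (by norm_num) ?_
    have := Real.exp_one_gt_d9
    rw [show (2 : ℝ) = 1 + 1 by norm_num, Real.exp_add]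
    nlinarith
  -- The three summands dominate on `X < y`, `X > (1 + 2τ) y` and the window between; the first two
  -- compare with the tilts by `y` and `(1 + 2τ) y`, whose moments `hub` controls.
  have hpt : ∀ ω, Real.exp ((1 + τ) * y * X ω) ≤
      Real.exp (τ * y ^ 2) * Real.exp (y * X ω) +
      Real.exp (-(τ * (1 + 2 * τ) * y ^ 2)) * Real.exp ((1 + 2 * τ) * y * X ω) +
      {ω | y ≤ X ω}.indicator (fun _ => Real.exp ((1 + τ) * (1 + 2 * τ) * y ^ 2)) ω := by
    intro ω
    rw [← Real.exp_add, ← Real.exp_add]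
    have h1 := Real.exp_pos (τ * y ^ 2 + y * X ω)
    have h2 := Real.exp_pos (-(τ * (1 + 2 * τ) * y ^ 2) + (1 + 2 * τ) * y * X ω)
    by_cases hω : y ≤ X ω
    · rw [Set.indicator_of_mem (by exact hω)]
      by_cases hω2 : X ω ≤ (1 + 2 * τ) * y
      · have : Real.exp ((1 + τ) * y * X ω) ≤ Real.exp ((1 + τ) * (1 + 2 * τ) * y ^ 2) := by
          rw [Real.exp_le_exp]
          have := mul_le_mul_of_nonneg_left hω2 (show 0 ≤ (1 + τ) * y by positivity)
          nlinarith
        linarith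
      · have : Real.exp ((1 + τ) * y * X ω) ≤
            Real.exp (-(τ * (1 + 2 * τ) * y ^ 2) + (1 + 2 * τ) * y * X ω) := by
          rw [Real.exp_le_exp]
          have := mul_le_mul_of_nonneg_left (not_le.1 hω2).le (show 0 ≤ τ * y by positivity)
          nlinarith
        have h3 := Real.exp_pos ((1 + τ) * (1 + 2 * τ) * y ^ 2)
        linarith
    · rw [Set.indicator_of_notMem (by exact hω)]
      have : Real.exp ((1 + τ) * y * X ω) ≤ Real.exp (τ * y ^ 2 + y * X ω) := by
        rw [Real.exp_le_exp]
        have := mul_le_mul_of_nonneg_left (not_le.1 hω).le (show 0 ≤ τ * y by positivity)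
        nlinarith
      linarith
  have hI1 := (hint y hy.le).const_mul (Real.exp (τ * y ^ 2))
  have hI2 := (hint ((1 + 2 * τ) * y) (by positivity)).const_mul
    (Real.exp (-(τ * (1 + 2 * τ) * y ^ 2)))
  have hI3 : Integrable ({ω | y ≤ X ω}.indicator
      (fun _ => Real.exp ((1 + τ) * (1 + 2 * τ) * y ^ 2))) μ :=
    (integrable_const _).indicator hmeas
  have hint3 := integral_mono (hint ((1 + τ) * y) (by positivity)) ((hI1.add hI2).add hI3) hpt
  simp only [Pi.add_apply] at hint3
  rw [integral_add (by exact hI1.add hI2) hI3, integral_add hI1 hI2, integral_const_mul,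
    integral_const_mul, integral_indicator_const _ hmeas, smul_eq_mul] at hint3
  have hb1 : Real.exp (τ * y ^ 2) * ∫ ω, Real.exp (y * X ω) ∂μ ≤ Real.exp L / 4 := by
    calc _ ≤ Real.exp (τ * y ^ 2) * Real.exp (y ^ 2 / 2 * (1 + τ ^ 2 / 26)) :=
          mul_le_mul_of_nonneg_left (hub y hy.le) (Real.exp_pos _).le
      _ ≤ Real.exp L * Real.exp (-2) := by
          rw [← Real.exp_add, ← Real.exp_add, Real.exp_le_exp, hL]
          nlinarith [mul_nonneg (mul_nonneg hy2.le (sq_nonneg τ)) (sub_nonneg.2 hτ1),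
            mul_nonneg (mul_nonneg hy2.le (sq_nonneg τ)) (sub_nonneg.2 (hτ2.trans hτ1))]
      _ ≤ _ := by
          have := Real.exp_pos L
          nlinarith
  have hb2 : Real.exp (-(τ * (1 + 2 * τ) * y ^ 2)) *
      ∫ ω, Real.exp ((1 + 2 * τ) * y * X ω) ∂μ ≤ Real.exp L / 4 := by
    calc _ ≤ Real.exp (-(τ * (1 + 2 * τ) * y ^ 2)) *
          Real.exp (((1 + 2 * τ) * y) ^ 2 / 2 * (1 + τ ^ 2 / 26)) :=
          mul_le_mul_of_nonneg_left (hub _ (by positivity)) (Real.exp_pos _).le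
      _ ≤ Real.exp L * Real.exp (-2) := by
          rw [← Real.exp_add, ← Real.exp_add, Real.exp_le_exp, hL]
          nlinarith [mul_nonneg (mul_nonneg hy2.le (sq_nonneg τ)) (sub_nonneg.2 hτ1),
            mul_nonneg (mul_nonneg hy2.le (sq_nonneg τ)) (sub_nonneg.2 (hτ2.trans hτ1))]
      _ ≤ _ := by
          have := Real.exp_pos L
          nlinarith
  have hhalf : Real.exp L / 2 ≤
      μ.real {ω | y ≤ X ω} * Real.exp ((1 + τ) * (1 + 2 * τ) * y ^ 2) := by linarith
  have hfin : Real.exp (-(y ^ 2 * (1 / 2 + 5 * τ))) * Real.exp ((1 + τ) * (1 + 2 * τ) * y ^ 2) ≤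
      Real.exp L / 2 := by
    calc _ ≤ Real.exp L * Real.exp (-2) := by
          rw [← Real.exp_add, ← Real.exp_add, Real.exp_le_exp, hL]
          nlinarith [mul_nonneg hy2.le (sub_nonneg.2 hτ2),
            mul_nonneg (mul_nonneg hy2.le (sq_nonneg τ)) (sub_nonneg.2 hτ1),
            mul_nonneg (mul_nonneg hy2.le (sq_nonneg τ)) (sub_nonneg.2 (hτ2.trans hτ1))]
      _ ≤ _ := by
          have := Real.exp_pos L
          nlinarith
  exact le_of_mul_le_mul_right (hfin.trans hhalf) (Real.exp_pos _)

/-! ### Moderate deviations of the quadratic form below its mean. -/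

section QuadForm

variable {w a : ℕ+ → ℝ} {m : ℝ}

/-- The centred deviation `E Q - Q` of the quadratic form `Q` below its mean. -/
noncomputable def deficit (w a ξ : ℕ+ → ℝ) : ℝ :=
  (∑' j, w j) + (∑' j, w j * a j ^ 2) - quadForm w a ξ

theorem measurable_deficit (hw : ∀ j, 0 ≤ w j) : Measurable (deficit w a) :=
  measurable_const.sub (measurable_quadForm hw)

theorem exp_mul_deficit (t : ℝ) (ξ : ℕ+ → ℝ) : Real.exp (t * deficit w a ξ) =
    Real.exp (t * ((∑' j, w j) + (∑' j, w j * a j ^ 2))) *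
      Real.exp (-(t * quadForm w a ξ)) := by
  rw [deficit, mul_sub, sub_eq_add_neg, Real.exp_add]

theorem integrable_exp_mul_deficit (hw : ∀ j, 0 ≤ w j) {t : ℝ} (ht : 0 ≤ t) :
    Integrable (fun ξ => Real.exp (t * deficit w a ξ)) noise := by
  simp_rw [exp_mul_deficit]
  refine Integrable.const_mul ((integrable_const (1 : ℝ)).mono' ?_ (ae_of_all _ fun ξ => ?_)) _
  · exact (Real.measurable_exp.comp
      ((measurable_quadForm hw).const_mul t).neg).aestronglyMeasurable
  · rw [Real.norm_eq_abs, Real.abs_exp, Real.exp_le_one_iff, neg_nonpos]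
    exact mul_nonneg ht (quadForm_nonneg hw ξ)

/-- The summand of the cumulant generating function of `deficit w a`. -/
noncomputable def cgfTerm (w a : ℕ+ → ℝ) (t : ℝ) (j : ℕ+) : ℝ :=
  t * (w j + w j * a j ^ 2) - (Real.log (1 + 2 * (t * w j)) / 2 +
    t * w j * a j ^ 2 / (1 + 2 * (t * w j)))

theorem summable_cgfTerm (hw : ∀ j, 0 ≤ w j) (hs : Summable w)
    (ha : Summable fun j => w j * a j ^ 2) {t : ℝ} (ht : 0 ≤ t) : Summable (cgfTerm w a t) :=
  ((hs.add ha).mul_left t).sub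
    ((summable_log_one_add hw hs ht).add (summable_shift_term hw ha ht))

theorem integral_exp_mul_deficit (hw : ∀ j, 0 ≤ w j) (hs : Summable w)
    (ha : Summable fun j => w j * a j ^ 2) {t : ℝ} (ht : 0 ≤ t) :
    ∫ ξ, Real.exp (t * deficit w a ξ) ∂noise = Real.exp (∑' j, cgfTerm w a t j) := by
  simp_rw [exp_mul_deficit]
  rw [integral_const_mul, integral_exp_neg_quadForm hw hs ha ht, ← Real.exp_add]
  congr 1
  unfold cgfTerm
  rw [((hs.add ha).mul_left t).tsum_sub
    ((summable_log_one_add hw hs ht).add (summable_shift_term hw ha ht)), tsum_mul_left,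
    hs.tsum_add ha, sub_eq_add_neg]

/-- The linear terms cancel by centring. The noise leaves `t² w_j²`, the Gaussian main term; the
shift leaves a second-order term, made a multiple of the summand of `B` by taking out one factor
`w_j ≤ m`. -/
theorem cgfTerm_le (hw : ∀ j, 0 ≤ w j) (hm : ∀ j, w j ≤ m) {t : ℝ} (ht : 0 ≤ t) (j : ℕ+) :
    cgfTerm w a t j ≤ t ^ 2 * w j ^ 2 + 2 * t ^ 2 * m * (w j * a j ^ 2) := by
  unfold cgfTerm
  set u := t * w j with hu
  have hu0 : 0 ≤ u := mul_nonneg ht (hw j)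
  have h1 := sub_sq_div_two_le_log_one_add (show 0 ≤ 2 * u by linarith)
  have h2 : u * a j ^ 2 - 2 * u ^ 2 * a j ^ 2 ≤ u * a j ^ 2 / (1 + 2 * u) := by
    rw [le_div_iff₀ (by linarith)]
    nlinarith [mul_nonneg (pow_nonneg hu0 3) (sq_nonneg (a j))]
  have h3 : u ^ 2 * a j ^ 2 ≤ t ^ 2 * m * (w j * a j ^ 2) := by
    have := mul_le_mul_of_nonneg_right (hm j)
      (mul_nonneg (mul_nonneg (sq_nonneg t) (hw j)) (sq_nonneg (a j)))
    rw [hu]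
    nlinarith
  have h4 : t * (w j + w j * a j ^ 2) = u + u * a j ^ 2 := by rw [hu]; ring
  have h5 : t ^ 2 * w j ^ 2 = u ^ 2 := by rw [hu]; ring
  rw [h4, h5]
  linarith

/-- The contribution of the shift is nonnegative and can be dropped; the cubic term of the logarithm
costs the relative error `4/3 * (t * m)`. -/
theorem le_cgfTerm (hw : ∀ j, 0 ≤ w j) (hm : ∀ j, w j ≤ m) {t : ℝ} (ht : 0 ≤ t) (j : ℕ+) :
    t ^ 2 * (1 - 4 / 3 * (t * m)) * w j ^ 2 ≤ cgfTerm w a t j := by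
  unfold cgfTerm
  set u := t * w j with hu
  have hu0 : 0 ≤ u := mul_nonneg ht (hw j)
  have h1 := log_one_add_le_cubic (show 0 ≤ 2 * u by linarith)
  have h2 : u * a j ^ 2 / (1 + 2 * u) ≤ u * a j ^ 2 := by
    rw [div_le_iff₀ (by linarith)]
    nlinarith [mul_nonneg (pow_nonneg hu0 2) (sq_nonneg (a j))]
  have h3 : u ^ 3 ≤ u ^ 2 * (t * m) := by
    have := mul_le_mul_of_nonneg_left (mul_le_mul_of_nonneg_left (hm j) ht) (sq_nonneg u)
    nlinarith
  have h4 : t * (w j + w j * a j ^ 2) = u + u * a j ^ 2 := by rw [hu]; ring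
  have h5 : t ^ 2 * (1 - 4 / 3 * (t * m)) * w j ^ 2 = u ^ 2 * (1 - 4 / 3 * (t * m)) := by
    rw [hu]; ring
  rw [h4, h5]
  linarith

theorem integral_exp_mul_deficit_le (hw : ∀ j, 0 ≤ w j) (hs : Summable w)
    (hq : HasSum (fun j => w j ^ 2) (1 / 2)) (ha : Summable fun j => w j * a j ^ 2)
    (hm : ∀ j, w j ≤ m) {t : ℝ} (ht : 0 ≤ t) :
    ∫ ξ, Real.exp (t * deficit w a ξ) ∂noise ≤
      Real.exp (t ^ 2 / 2 * (1 + 4 * (m * ∑' j, w j * a j ^ 2))) := by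
  rw [integral_exp_mul_deficit hw hs ha ht, Real.exp_le_exp]
  have h := hasSum_le (cgfTerm_le hw hm ht) (summable_cgfTerm hw hs ha ht).hasSum
    ((hq.mul_left (t ^ 2)).add (ha.hasSum.mul_left (2 * t ^ 2 * m)))
  linarith

theorem le_integral_exp_mul_deficit (hw : ∀ j, 0 ≤ w j) (hs : Summable w)
    (hq : HasSum (fun j => w j ^ 2) (1 / 2)) (ha : Summable fun j => w j * a j ^ 2)
    (hm : ∀ j, w j ≤ m) {t : ℝ} (ht : 0 ≤ t) :
    Real.exp (t ^ 2 / 2 * (1 - 4 / 3 * (t * m))) ≤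
      ∫ ξ, Real.exp (t * deficit w a ξ) ∂noise := by
  rw [integral_exp_mul_deficit hw hs ha ht, Real.exp_le_exp]
  have h := hasSum_le (le_cgfTerm hw hm ht) (hq.mul_left (t ^ 2 * (1 - 4 / 3 * (t * m))))
    (summable_cgfTerm hw hs ha ht).hasSum
  linarith

/-- Chernoff's bound at `t = y`, the optimal exponent for a standard Gaussian. -/
theorem measureReal_le_deficit_le (hw : ∀ j, 0 ≤ w j) (hs : Summable w)
    (hq : HasSum (fun j => w j ^ 2) (1 / 2)) (ha : Summable fun j => w j * a j ^ 2)
    (hm : ∀ j, w j ≤ m) {y : ℝ} (hy : 0 ≤ y) :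
    noise.real {ξ | y ≤ deficit w a ξ} ≤
      Real.exp (-(y ^ 2 / 2 * (1 - 4 * (m * ∑' j, w j * a j ^ 2)))) := by
  have h := measure_ge_le_exp_mul_mgf y hy (integrable_exp_mul_deficit (a := a) hw hy)
  refine h.trans ?_
  have h2 := integral_exp_mul_deficit_le hw hs hq ha hm hy
  calc _ ≤ Real.exp (-y * y) * Real.exp (y ^ 2 / 2 * (1 + 4 * (m * ∑' j, w j * a j ^ 2))) :=
        mul_le_mul_of_nonneg_left h2 (Real.exp_pos _).le
    _ = _ := by
        rw [← Real.exp_add]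
        congr 1
        ring

theorem exp_neg_le_measureReal_le_deficit (hw : ∀ j, 0 ≤ w j) (hs : Summable w)
    (hq : HasSum (fun j => w j ^ 2) (1 / 2)) (ha : Summable fun j => w j * a j ^ 2)
    (hm : ∀ j, w j ≤ m) {τ y : ℝ} (hτ : 0 < τ) (hτ1 : τ ≤ 1) (hy : 0 < y)
    (hyτ : 8 ≤ (y * τ) ^ 2) (hb : 4 * (m * ∑' j, w j * a j ^ 2) ≤ τ ^ 2 / 26)
    (hym : 4 * (m * y) ≤ τ ^ 2 / 26) :
    Real.exp (-(y ^ 2 * (1 / 2 + 5 * τ))) ≤ noise.real {ξ | y ≤ deficit w a ξ} := by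
  refine exp_neg_le_measureReal_of_mgf_bounds (measurable_deficit hw) hτ hτ1 hy hyτ
    (fun t ht => integrable_exp_mul_deficit hw ht) (fun t ht => ?_) ?_
  · refine (integral_exp_mul_deficit_le hw hs hq ha hm ht).trans ?_
    rw [Real.exp_le_exp]
    gcongr
  · refine le_trans ?_ (le_integral_exp_mul_deficit hw hs hq ha hm (by positivity))
    rw [Real.exp_le_exp]
    have hm0 : 0 ≤ m := (hw 1).trans (hm 1)
    gcongr
    have : (1 + τ) * (m * y) ≤ 2 * (m * y) := by
      have := mul_nonneg hm0 hy.le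
      nlinarith
    nlinarith

end QuadForm

/-! ### Error probabilities as tails of the quadratic form. -/

/-- The weights `κ_{εj}² / (ε² (2 A_ε)^{1/2})` of the normalised test statistic. -/
noncomputable def weight (κ : ℝ → ℕ → ℝ) (ε : ℝ) (j : ℕ+) : ℝ :=
  κ ε j ^ 2 / (ε ^ 2 * √(2 * A κ ε))

section Reduction

variable {φ : ℕ+ → L2} {κ : ℝ → ℕ → ℝ} {ε x : ℝ} {S : L2}

theorem weight_nonneg (κ : ℝ → ℕ → ℝ) (ε : ℝ) (j : ℕ+) : 0 ≤ weight κ ε j := by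
  unfold weight; positivity

theorem summable_weight (hs : Summable fun j : ℕ+ => κ ε j ^ 2) : Summable (weight κ ε) :=
  hs.div_const _

theorem hasSum_weight_sq (hε : 0 < ε) (hA : 0 < A κ ε) :
    HasSum (fun j => weight κ ε j ^ 2) (1 / 2) := by
  have hs : Summable fun j : ℕ+ => κ ε j ^ 4 := by
    -- A divergent series has `tsum` equal to `0`, so `A κ ε > 0` already gives summability of the
    -- fourth powers.
    by_contra h
    rw [A, tsum_eq_zero_of_not_summable h, mul_zero] at hA
    exact hA.false
  have h := hs.hasSum.div_const ((ε ^ 2 * √(2 * A κ ε)) ^ 2)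
  have hA' : ∑' j : ℕ+, κ ε j ^ 4 = A κ ε * ε ^ 4 := by
    rw [A]
    field_simp
  have hsq : √(2 * A κ ε) ^ 2 = 2 * A κ ε := Real.sq_sqrt (by positivity)
  have hv : (∑' j : ℕ+, κ ε j ^ 4) / (ε ^ 2 * √(2 * A κ ε)) ^ 2 = 1 / 2 := by
    rw [hA', mul_pow, hsq]
    field_simp
  rw [hv] at h
  have he : (fun j => weight κ ε j ^ 2) =
      fun j : ℕ+ => κ ε j ^ 4 / (ε ^ 2 * √(2 * A κ ε)) ^ 2 := by
    funext j
    rw [weight, div_pow]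
    ring
  rwa [he]

theorem summable_coeff_sq (hφ : Orthonormal ℝ φ) (S : L2) : Summable fun j => coeff φ S j ^ 2 := by
  have h := hφ.inner_products_summable (x := S)
  simpa [coeff] using h

theorem tsum_coeff_sq_le (hφ : Orthonormal ℝ φ) (S : L2) : ∑' j, coeff φ S j ^ 2 ≤ ‖S‖ ^ 2 := by
  have h := hφ.tsum_inner_products_le (x := S)
  simpa [coeff] using h

theorem weight_le_tsum (hs : Summable fun j : ℕ+ => κ ε j ^ 2) (j : ℕ+) :
    weight κ ε j ≤ ∑' i, weight κ ε i :=
  (summable_weight hs).le_tsum j fun i _ => weight_nonneg κ ε i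

theorem summable_weight_mul_sq (hφ : Orthonormal ℝ φ) (hs : Summable fun j : ℕ+ => κ ε j ^ 2)
    (S : L2) : Summable fun j => weight κ ε j * (coeff φ S j / ε) ^ 2 := by
  refine Summable.of_nonneg_of_le (fun j => mul_nonneg (weight_nonneg κ ε j) (sq_nonneg _))
    (fun j => mul_le_mul_of_nonneg_right (weight_le_tsum hs j) (sq_nonneg _)) ?_
  simp_rw [div_pow]
  exact ((summable_coeff_sq hφ S).div_const _).mul_left _

theorem B_eq_tsum (φ : ℕ+ → L2) (κ : ℝ → ℕ → ℝ) (ε : ℝ) (S : L2) :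
    B φ κ ε S = ∑' j, weight κ ε j * (coeff φ S j / ε) ^ 2 := by
  rw [B, D, mul_div_right_comm, ← tsum_mul_left]
  refine tsum_congr fun j => ?_
  rw [weight, div_pow]
  simp only [div_eq_mul_inv, mul_inv]
  ring

theorem B_nonneg (φ : ℕ+ → L2) (κ : ℝ → ℕ → ℝ) (ε : ℝ) (S : L2) : 0 ≤ B φ κ ε S := by
  rw [B_eq_tsum]
  exact tsum_nonneg fun j => mul_nonneg (weight_nonneg κ ε j) (sq_nonneg _)

theorem statistic_eq (hε : 0 < ε) (S : L2) (ξ : ℕ+ → ℝ) :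
    (ε ^ 2)⁻¹ * T κ ε (obs φ ε S ξ) / √(2 * A κ ε) =
      quadForm (weight κ ε) (fun j => coeff φ S j / ε) ξ - ∑' j, weight κ ε j := by
  have h1 : ∑' j, weight κ ε j = rhoSq κ ε / (ε ^ 2 * √(2 * A κ ε)) := by
    rw [rhoSq, ← tsum_div_const]
    rfl
  have h2 : quadForm (weight κ ε) (fun j => coeff φ S j / ε) ξ =
      (∑' j : ℕ+, κ ε j ^ 2 * obs φ ε S ξ j ^ 2) / (ε ^ 2 * (ε ^ 2 * √(2 * A κ ε))) := by
    rw [quadForm, ← tsum_div_const]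
    refine tsum_congr fun j => ?_
    rw [weight, obs]
    have : coeff φ S j / ε + ξ j = (coeff φ S j + ε * ξ j) / ε := by
      field_simp
    rw [this, div_pow]
    simp only [div_eq_mul_inv, mul_inv]
    ring
  rw [h1, h2, T]
  simp only [div_eq_mul_inv, mul_inv]
  ring

theorem setOf_obs_notMem_rejectRegion (hε : 0 < ε) (x : ℝ) (S : L2) :
    {ξ | obs φ ε S ξ ∉ rejectRegion κ ε x} =
      {ξ | B φ κ ε S - x ≤ deficit (weight κ ε) (fun j => coeff φ S j / ε) ξ} := by
  ext ξ
  rw [Set.mem_ofPred_eq, rejectRegion, Set.mem_ofPred_eq, Set.mem_ofPred_eq, statistic_eq hε,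
    B_eq_tsum, deficit, not_lt]
  constructor <;> intro h <;> linarith

theorem typeII_eq (hε : 0 < ε) (x : ℝ) (S : L2) : typeII φ κ ε x S =
    noise {ξ | B φ κ ε S - x ≤ deficit (weight κ ε) (fun j => coeff φ S j / ε) ξ} := by
  rw [typeII, setOf_obs_notMem_rejectRegion hε]

theorem typeI_add_typeII (hε : 0 < ε) (x : ℝ) : typeI φ κ ε x + typeII φ κ ε x 0 = 1 := by
  have hm : MeasurableSet {ξ | obs φ ε 0 ξ ∉ rejectRegion κ ε x} := by
    rw [setOf_obs_notMem_rejectRegion hε]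
    exact measurableSet_le measurable_const (measurable_deficit (weight_nonneg κ ε))
  rw [typeI, typeII, ← prob_add_prob_compl (μ := noise) hm, add_comm]
  congr 2
  ext ξ
  simp

theorem B_zero (φ : ℕ+ → L2) (κ : ℝ → ℕ → ℝ) (ε : ℝ) : B φ κ ε 0 = 0 := by
  simp [B, D, coeff]

theorem typeII_toReal_le (hφ : Orthonormal ℝ φ) (hε : 0 < ε)
    (hs : Summable fun j : ℕ+ => κ ε j ^ 2) (hA : 0 < A κ ε) {m : ℝ}
    (hm : ∀ j, weight κ ε j ≤ m) (hx : 0 ≤ B φ κ ε S - x) :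
    (typeII φ κ ε x S).toReal ≤
      Real.exp (-((B φ κ ε S - x) ^ 2 / 2 * (1 - 4 * (m * B φ κ ε S)))) := by
  rw [typeII_eq hε]
  refine (measureReal_le_deficit_le (weight_nonneg κ ε) (summable_weight hs)
    (hasSum_weight_sq hε hA) (summable_weight_mul_sq hφ hs S) hm hx).trans_eq ?_
  rw [← B_eq_tsum]

theorem exp_neg_le_typeII_toReal (hφ : Orthonormal ℝ φ) (hε : 0 < ε)
    (hs : Summable fun j : ℕ+ => κ ε j ^ 2) (hA : 0 < A κ ε) {m : ℝ}
    (hm : ∀ j, weight κ ε j ≤ m) {τ y : ℝ} (hτ : 0 < τ) (hτ1 : τ ≤ 1) (hy : 0 < y)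
    (hxy : B φ κ ε S - x ≤ y) (hyτ : 8 ≤ (y * τ) ^ 2)
    (hb : 4 * (m * B φ κ ε S) ≤ τ ^ 2 / 26) (hym : 4 * (m * y) ≤ τ ^ 2 / 26) :
    Real.exp (-(y ^ 2 * (1 / 2 + 5 * τ))) ≤ (typeII φ κ ε x S).toReal := by
  rw [typeII_eq hε]
  rw [B_eq_tsum] at hb
  refine (exp_neg_le_measureReal_le_deficit (weight_nonneg κ ε) (summable_weight hs)
    (hasSum_weight_sq hε hA) (summable_weight_mul_sq hφ hs S) hm hτ hτ1 hy hyτ hb hym).trans ?_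
  exact measureReal_mono fun ξ hξ => hxy.trans hξ

theorem exp_neg_two_le_half : Real.exp (-2) ≤ 1 / 2 := by
  rw [Real.exp_neg, one_div]
  refine inv_anti₀ (by norm_num) ?_
  linarith [Real.add_one_le_exp (2 : ℝ)]

/-- Used twice: the constant threshold `-2` may be inserted in the definition of LD consistency, and
a vanishing type I error forces `x ≥ -2` eventually. At `S = 0` one has `B = 0`, so any bound on the
weights serves and the acceptance probability is at most `exp (-2)`. -/
theorem half_le_typeI (hφ : Orthonormal ℝ φ) (hε : 0 < ε)
    (hs : Summable fun j : ℕ+ => κ ε j ^ 2) (hA : 0 < A κ ε) (hx : x ≤ -2) :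
    1 / 2 ≤ typeI φ κ ε x := by
  have h1 := typeII_toReal_le (x := x) hφ hε hs hA (S := 0) (weight_le_tsum hs)
    (by rw [B_zero]; linarith)
  have h2 : (typeII φ κ ε x 0).toReal ≤ 1 / 2 := by
    refine h1.trans (le_trans ?_ exp_neg_two_le_half)
    rw [Real.exp_le_exp, B_zero]
    nlinarith
  have hne : typeII φ κ ε x 0 ≠ ∞ := measure_ne_top _ _
  have h3 : typeII φ κ ε x 0 ≤ 1 / 2 := by
    rw [← ENNReal.ofReal_toReal hne]
    refine (ENNReal.ofReal_le_ofReal h2).trans_eq ?_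
    rw [ENNReal.ofReal_div_of_pos two_pos]
    simp
  by_contra h
  rw [not_le] at h
  have h4 := typeI_add_typeII (φ := φ) (κ := κ) hε x
  have h5 : typeI φ κ ε x + typeII φ κ ε x 0 < 1 / 2 + 1 / 2 :=
    ENNReal.add_lt_add_of_lt_of_le hne h h3
  rw [h4, ENNReal.add_halves] at h5
  exact h5.false

theorem absLog_eq {p : ℝ≥0∞} (hp : 0 < p.toReal) :
    absLog p = ENNReal.ofReal |Real.log p.toReal| := by
  rw [absLog, ENNReal.log_pos_real' hp, EReal.abs_def]

theorem typeII_toReal_le_one : (typeII φ κ ε x S).toReal ≤ 1 := measureReal_le_one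

end Reduction

/-! ### Comparison of type II errors at a fixed noise level. -/

theorem abs_sub_le_and_le_of_bounds {y y₁ τ ρ δ l l₁ l₂ : ℝ} (hτ : 0 < τ) (hτ2 : τ ≤ 1 / 2)
    (hρ : 0 < ρ) (hρ1 : ρ ≤ 1) (hδ : 6 * τ + ρ ≤ δ / 4) (hδ2 : 16 * ρ ≤ δ / 4)
    (hy₁ : y₁ ≤ y) (hyy : (1 - ρ) * y ≤ y₁) (hy : 0 < y)
    (hl : y ^ 2 / 2 * (1 - τ) ≤ l) (hl' : l ≤ y ^ 2 * (1 / 2 + 5 * τ))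
    (hl₁ : y₁ ^ 2 / 2 * (1 - τ) ≤ l₁) (hl₁' : l₁ ≤ y₁ ^ 2 * (1 / 2 + 5 * τ))
    (hl₂ : l₂ ≤ (2 * ρ * y) ^ 2 * (1 / 2 + 5 * τ)) :
    |l - l₁| ≤ δ * l ∧ l₂ ≤ δ * l := by
  have hy2 : 0 < y ^ 2 := by positivity
  have h0 : 0 ≤ (1 - ρ) * y := mul_nonneg (by linarith) hy.le
  have hup : y₁ ^ 2 ≤ y ^ 2 := by gcongr; linarith
  have hlow : (1 - 2 * ρ) * y ^ 2 ≤ y₁ ^ 2 := by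
    have : ((1 - ρ) * y) ^ 2 ≤ y₁ ^ 2 := by gcongr
    nlinarith [mul_nonneg (sq_nonneg ρ) hy2.le]
  have hδ0 : 0 < δ := by linarith
  have hl4 : y ^ 2 / 4 ≤ l := by nlinarith
  have hδl : δ / 4 * y ^ 2 ≤ δ * l := by nlinarith
  have hc := mul_le_mul_of_nonneg_right hδ hy2.le
  have hc2 := mul_le_mul_of_nonneg_right hδ2 hy2.le
  have hlow' : (1 - 2 * ρ) * y ^ 2 / 2 * (1 - τ) ≤ l₁ := by
    refine le_trans ?_ hl₁
    have := mul_le_mul_of_nonneg_right hlow (show 0 ≤ 1 - τ by linarith)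
    linarith
  have hup' : l₁ ≤ y ^ 2 * (1 / 2 + 5 * τ) :=
    hl₁'.trans (mul_le_mul_of_nonneg_right hup (by positivity))
  have hτy := mul_pos hτ hy2
  have hρy := mul_pos hρ hy2
  refine ⟨abs_le.2 ⟨?_, ?_⟩, ?_⟩
  · linarith
  · nlinarith [mul_pos hρ hτy]
  · have h1 : (2 * ρ * y) ^ 2 * (1 / 2 + 5 * τ) ≤ (4 * ρ * y ^ 2) * 3 := by
      have h2 : (2 * ρ * y) ^ 2 ≤ 4 * ρ * y ^ 2 := by nlinarith [mul_nonneg hρy.le (sub_nonneg.2 hρ1)]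
      exact mul_le_mul h2 (by linarith) (by positivity) (by positivity)
    linarith

/-- Since `B - x ≥ c * B`, a remainder with `B` at most `ρ * c * B` shifts the deviation `y = B - x`
by at most `ρ * y`. So `y²` changes by a relative amount of order `ρ`, and the remainder alone
yields an exponent of order `ρ² y²`. -/
theorem typeII_comparison {φ : ℕ+ → L2} {κ : ℝ → ℕ → ℝ} {ε x m c ρ η τ δ : ℝ} {S S₁ : L2}
    (hφ : Orthonormal ℝ φ) (hε : 0 < ε)
    (hs : Summable fun j : ℕ+ => κ ε j ^ 2) (hA : 0 < A κ ε) (hm : ∀ j, weight κ ε j ≤ m)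
    (hadd : B φ κ ε S = B φ κ ε S₁ + B φ κ ε (S - S₁)) (hη : B φ κ ε (S - S₁) ≤ η * B φ κ ε S)
    (hηρ : η ≤ ρ * c) (hc : 0 < c) (hx : c * B φ κ ε S ≤ B φ κ ε S - x) (hx2 : -2 ≤ x)
    (hB : 2 ≤ B φ κ ε S) (hρB : 2 ≤ ρ * (c * B φ κ ε S))
    (hτB : 8 ≤ (2 * (ρ * (c * B φ κ ε S)) * τ) ^ 2)
    (hmB : 8 * (m * B φ κ ε S) ≤ τ ^ 2 / 26)
    (hτ : 0 < τ) (hτ2 : τ ≤ 1 / 2) (hρ : 0 < ρ) (hρ1 : ρ ≤ 1 / 4)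
    (hδ : 6 * τ + ρ ≤ δ / 4) (hδ2 : 16 * ρ ≤ δ / 4) :
    (ENNReal.log (typeII φ κ ε x S) - ENNReal.log (typeII φ κ ε x S₁)).abs ≤
        ENNReal.ofReal δ * absLog (typeII φ κ ε x S) ∧
      absLog (typeII φ κ ε x (S - S₁)) ≤ ENNReal.ofReal δ * absLog (typeII φ κ ε x S) := by
  set b := B φ κ ε S with hb
  set b₁ := B φ κ ε S₁ with hb₁
  set b₂ := B φ κ ε (S - S₁) with hb₂
  have hb₁0 : 0 ≤ b₁ := B_nonneg ..
  have hb₂0 : 0 ≤ b₂ := B_nonneg ..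
  have hm0 : 0 ≤ m := (weight_nonneg κ ε 1).trans (hm 1)
  have hcb : 0 < c * b := by positivity
  have hη2 : b₂ ≤ ρ * (c * b) := by
    refine hη.trans ?_
    have := mul_le_mul_of_nonneg_right hηρ (by linarith : 0 ≤ b)
    linarith
  set y := b - x with hy
  have hy0 : 0 < y := hcb.trans_le hx
  have hyb : y ≤ 2 * b := by linarith
  have hρy : ρ * (c * b) ≤ ρ * y := mul_le_mul_of_nonneg_left hx hρ.le
  have hρy4 : ρ * y ≤ y / 4 := by nlinarith
  set y₁ := b₁ - x with hy₁
  have hy₁y : y₁ ≤ y := by linarith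
  have hyy₁ : (1 - ρ) * y ≤ y₁ := by linarith
  -- `z` majorises the deviation `b₂ - x` of the remainder, as `b₂` and `-x ≤ 2` are each at most `ρ
  -- * (c * b)`. The lower tail bound needs a positive, large level, which `b₂ - x` need not be; `z`
  -- is one, and it also lies below `y` and `y₁`.
  set z := 2 * (ρ * (c * b)) with hz
  have hz0 : 0 < z := by positivity
  have hzy : z ≤ y := by linarith
  have hzy₁ : z ≤ y₁ := by linarith
  have hτ26 : τ ^ 2 / 26 ≤ τ := by nlinarith
  have hmy : 4 * (m * y) ≤ τ ^ 2 / 26 := by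
    have := mul_le_mul_of_nonneg_left hyb hm0
    linarith
  have hmb := mul_nonneg hm0 (by linarith : 0 ≤ b)
  have hmono : ∀ u, u ≤ y → 4 * (m * u) ≤ τ ^ 2 / 26 := fun u hu => by
    have := mul_le_mul_of_nonneg_left hu hm0
    linarith
  have hmonoB : ∀ u, u ≤ b → 4 * (m * u) ≤ τ ^ 2 / 26 := fun u hu => by
    have := mul_le_mul_of_nonneg_left hu hm0
    linarith
  have hbig : ∀ u, z ≤ u → 8 ≤ (u * τ) ^ 2 := fun u hu => hτB.trans (by gcongr)
  have hτ1 : τ ≤ 1 := by linarith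
  have hlo := exp_neg_le_typeII_toReal (S := S) (x := x) (y := y) hφ hε hs hA hm hτ hτ1 hy0 le_rfl
    (hbig y hzy) (hmonoB b le_rfl) (hmono y le_rfl)
  have hlo₁ := exp_neg_le_typeII_toReal (S := S₁) (x := x) (y := y₁) hφ hε hs hA hm hτ hτ1
    (hz0.trans_le hzy₁) le_rfl (hbig y₁ hzy₁) (hmonoB b₁ (by linarith)) (hmono y₁ hy₁y)
  have hlo₂ := exp_neg_le_typeII_toReal (S := S - S₁) (x := x) (y := z) hφ hε hs hA hm hτ hτ1
    hz0 (by linarith) (hbig z le_rfl) (hmonoB b₂ (by linarith)) (hmono z hzy)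
  have hup := typeII_toReal_le (S := S) (x := x) hφ hε hs hA hm hy0.le
  have hup₁ := typeII_toReal_le (S := S₁) (x := x) hφ hε hs hA hm (hz0.trans_le hzy₁).le
  have hp := (Real.exp_pos _).trans_le hlo
  have hp₁ := (Real.exp_pos _).trans_le hlo₁
  have hp₂ := (Real.exp_pos _).trans_le hlo₂
  have hl := (Real.le_log_iff_exp_le hp).2 hlo
  have hl₁ := (Real.le_log_iff_exp_le hp₁).2 hlo₁
  have hl₂ := (Real.le_log_iff_exp_le hp₂).2 hlo₂
  have hu := (Real.log_le_iff_le_exp hp).2 hup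
  have hu₁ := (Real.log_le_iff_le_exp hp₁).2 hup₁
  have hn := Real.log_nonpos hp.le typeII_toReal_le_one
  have hn₂ := Real.log_nonpos hp₂.le typeII_toReal_le_one
  have hz2 : z ^ 2 * (1 / 2 + 5 * τ) ≤ (2 * ρ * y) ^ 2 * (1 / 2 + 5 * τ) := by
    gcongr
    linarith
  have h := abs_sub_le_and_le_of_bounds (y := y) (y₁ := y₁) (l := -Real.log (typeII φ κ ε x S).toReal)
    (l₁ := -Real.log (typeII φ κ ε x S₁).toReal)
    (l₂ := -Real.log (typeII φ κ ε x (S - S₁)).toReal) hτ hτ2 hρ (by linarith) hδ hδ2 hy₁y hyy₁ hy0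
    (by
      have := mul_le_mul_of_nonneg_left (show 1 - τ ≤ 1 - 4 * (m * b) by linarith [hmonoB b le_rfl])
        (by positivity : 0 ≤ y ^ 2 / 2)
      linarith) (by linarith)
    (by
      have := mul_le_mul_of_nonneg_left
        (show 1 - τ ≤ 1 - 4 * (m * b₁) by linarith [hmonoB b₁ (by linarith)])
        (by positivity : 0 ≤ y₁ ^ 2 / 2)
      linarith) (by linarith) (by linarith)
  have hδ0 : 0 ≤ δ := by linarith
  rw [absLog_eq hp, absLog_eq hp₂, ENNReal.log_pos_real' hp, ENNReal.log_pos_real' hp₁,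
    ← EReal.coe_sub, EReal.abs_def, ← ENNReal.ofReal_mul hδ0, abs_of_nonpos hn, abs_of_nonpos hn₂]
  refine ⟨ENNReal.ofReal_le_ofReal ?_, ENNReal.ofReal_le_ofReal h.2⟩
  have h1 := h.1
  rwa [neg_sub_neg, abs_sub_comm] at h1

/-! ### Truncated Fourier series. -/

/-- The set `{1, …, n}` of positive integers. -/
def initialSegment (n : ℕ) : Finset ℕ+ :=
  (Finset.range n).map ⟨Nat.succPNat, Nat.succPNat_injective⟩

theorem mem_initialSegment {n : ℕ} {j : ℕ+} : j ∈ initialSegment n ↔ (j : ℕ) ≤ n := by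
  simp only [initialSegment, Finset.mem_map, Finset.mem_range, Function.Embedding.coeFn_mk]
  constructor
  · rintro ⟨i, hi, rfl⟩
    exact hi
  · intro h
    exact ⟨j.natPred, by have := PNat.natPred_add_one j; omega, PNat.succPNat_natPred j⟩

theorem card_initialSegment (n : ℕ) : (initialSegment n).card = n := by
  simp [initialSegment]

/-- The partial sum `∑_{j ≤ n} θ_j φ_j` of the Fourier series of `S`. -/
noncomputable def trunc (φ : ℕ+ → L2) (n : ℕ) (S : L2) : L2 :=
  ∑ j ∈ initialSegment n, coeff φ S j • φ j

section Trunc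

variable {φ : ℕ+ → L2}

theorem coeff_trunc (hφ : Orthonormal ℝ φ) (n : ℕ) (S : L2) (j : ℕ+) :
    coeff φ (trunc φ n S) j = if (j : ℕ) ≤ n then coeff φ S j else 0 := by
  rw [coeff, trunc, inner_sum]
  simp_rw [inner_smul_right, orthonormal_iff_ite.1 hφ j, mul_ite, mul_one, mul_zero]
  rw [Finset.sum_ite_eq]
  simp only [mem_initialSegment]

theorem coeff_sub_trunc (hφ : Orthonormal ℝ φ) (n : ℕ) (S : L2) (j : ℕ+) :
    coeff φ (S - trunc φ n S) j = if (j : ℕ) ≤ n then 0 else coeff φ S j := by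
  have h : coeff φ (S - trunc φ n S) j = coeff φ S j - coeff φ (trunc φ n S) j :=
    inner_sub_right _ _ _
  rw [h, coeff_trunc hφ]
  split_ifs <;> simp

theorem inner_trunc_sub_trunc (hφ : Orthonormal ℝ φ) (n : ℕ) (S : L2) :
    inner ℝ (trunc φ n S) (S - trunc φ n S) = 0 := by
  conv_lhs => enter [2]; rw [trunc]
  rw [sum_inner]
  refine Finset.sum_eq_zero fun j hj => ?_
  rw [real_inner_smul_left]
  have h := coeff_sub_trunc hφ n S j
  rw [if_pos (mem_initialSegment.1 hj), coeff] at h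
  rw [h, mul_zero]

theorem norm_trunc_le (hφ : Orthonormal ℝ φ) (n : ℕ) (S : L2) : ‖trunc φ n S‖ ≤ ‖S‖ := by
  have h := norm_add_sq_eq_norm_sq_add_norm_sq_of_inner_eq_zero _ _ (inner_trunc_sub_trunc hφ n S)
  rw [add_sub_cancel] at h
  nlinarith [norm_nonneg S, norm_nonneg (trunc φ n S), norm_nonneg (S - trunc φ n S)]

theorem hasSum_trunc (hφ : Orthonormal ℝ φ) (n : ℕ) (S : L2) :
    HasSum (fun j => coeff φ (trunc φ n S) j • φ j) (trunc φ n S) := by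
  have h : trunc φ n S = ∑ j ∈ initialSegment n, coeff φ (trunc φ n S) j • φ j := by
    conv_lhs => rw [trunc]
    refine Finset.sum_congr rfl fun j hj => ?_
    rw [coeff_trunc hφ, if_pos (mem_initialSegment.1 hj)]
  conv => enter [2]; rw [h]
  refine hasSum_sum_of_ne_finset_zero fun j hj => ?_
  rw [coeff_trunc hφ, if_neg (mem_initialSegment.not.1 hj), zero_smul]

/-- The tail sum vanishes for `t ≥ n`, and for `t < n` Bessel's inequality bounds it by `‖S‖²`. -/
theorem trunc_mem_besovBall (hφ : Orthonormal ℝ φ) (n : ℕ) (S : L2) {s P₀ : ℝ} (hs : 0 < s)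
    (hP : (n : ℝ) ^ (2 * s) * ‖S‖ ^ 2 ≤ P₀) :
    trunc φ n S ∈ besovBall φ s P₀ := by
  refine ⟨_, hasSum_trunc hφ n S, fun t ht => le_trans ?_ hP⟩
  have hle : ∀ j : ℕ+, (if t < (j : ℝ) then coeff φ (trunc φ n S) j ^ 2 else 0) ≤
      coeff φ S j ^ 2 := by
    intro j
    rw [coeff_trunc hφ]
    split_ifs <;> simp [sq_nonneg]
  have hnn : ∀ j : ℕ+, 0 ≤ (if t < (j : ℝ) then coeff φ (trunc φ n S) j ^ 2 else 0) := by
    intro j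
    split_ifs <;> simp [sq_nonneg]
  by_cases htn : t < n
  · refine mul_le_mul (by gcongr) ?_ (tsum_nonneg hnn) (by positivity)
    refine le_trans ?_ (tsum_coeff_sq_le hφ S)
    exact (Summable.of_nonneg_of_le hnn hle (summable_coeff_sq hφ S)).tsum_le_tsum hle
      (summable_coeff_sq hφ S)
  · have h0 : ∀ j : ℕ+, (if t < (j : ℝ) then coeff φ (trunc φ n S) j ^ 2 else 0) = 0 := by
      intro j
      split_ifs with htj
      · have : ¬ (j : ℕ) ≤ n := fun h => htn (htj.trans_le (by exact_mod_cast h))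
        rw [coeff_trunc hφ, if_neg this, zero_pow two_ne_zero]
      · rfl
    simp_rw [h0]
    rw [tsum_zero, mul_zero]
    positivity

theorem B_eq_B_trunc_add (hφ : Orthonormal ℝ φ) (n : ℕ) (S : L2) {κ : ℝ → ℕ → ℝ} {ε : ℝ}
    (hs : Summable fun j : ℕ+ => κ ε j ^ 2) :
    B φ κ ε S = B φ κ ε (trunc φ n S) + B φ κ ε (S - trunc φ n S) := by
  simp_rw [B_eq_tsum]
  rw [← (summable_weight_mul_sq hφ hs _).tsum_add (summable_weight_mul_sq hφ hs _)]
  refine tsum_congr fun j => ?_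
  rw [coeff_trunc hφ, coeff_sub_trunc hφ]
  split_ifs <;> simp

theorem B_sub_trunc_le (hφ : Orthonormal ℝ φ) (n : ℕ) (S : L2) {κ : ℝ → ℕ → ℝ} {ε W : ℝ}
    (hs : Summable fun j : ℕ+ => κ ε j ^ 2)
    (hW : 0 ≤ W) (hw : ∀ j : ℕ+, n < j → weight κ ε j ≤ W) :
    B φ κ ε (S - trunc φ n S) ≤ W * (‖S‖ / ε) ^ 2 := by
  have h1 : B φ κ ε (S - trunc φ n S) ≤ ∑' j, W / ε ^ 2 * coeff φ S j ^ 2 := by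
    rw [B_eq_tsum]
    refine (summable_weight_mul_sq hφ hs _).tsum_le_tsum (fun j => ?_)
      ((summable_coeff_sq hφ S).mul_left _)
    rw [coeff_sub_trunc hφ]
    split_ifs with hj
    · simp only [zero_div, ne_eq, OfNat.ofNat_ne_zero, not_false_eq_true, zero_pow, mul_zero]
      positivity
    · rw [div_pow, div_mul_eq_mul_div, mul_div_assoc]
      exact mul_le_mul_of_nonneg_right (hw j (not_le.1 hj)) (by positivity)
  refine h1.trans ?_
  rw [tsum_mul_left, div_pow, div_mul_eq_mul_div, ← mul_div_assoc]
  gcongr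
  exact tsum_coeff_sq_le hφ S

theorem B_le (hφ : Orthonormal ℝ φ) (S : L2) {κ : ℝ → ℕ → ℝ} {ε m : ℝ}
    (hs : Summable fun j : ℕ+ => κ ε j ^ 2)
    (hm : ∀ j, weight κ ε j ≤ m) : B φ κ ε S ≤ m * (‖S‖ / ε) ^ 2 := by
  have h := B_sub_trunc_le hφ 0 S hs ((weight_nonneg κ ε 1).trans (hm 1)) fun j _ => hm j
  simpa [trunc, initialSegment] using h

end Trunc

/-! ### Size of the weights and of `B` as `ε → 0+`. -/

section Asymptotic

theorem tendsto_rpow_nhdsGT_zero {p : ℝ} (hp : 0 < p) :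
    Tendsto (fun ε : ℝ => ε ^ p) (𝓝[>] 0) (𝓝 0) := by
  have h := (Real.continuousAt_rpow_const 0 p (Or.inr hp.le)).tendsto
  rw [Real.zero_rpow hp.ne'] at h
  exact h.mono_left nhdsWithin_le_nhds

/-- The first `k_ε` squared weights are each at least that at `k_ε` and sum to at most `1/2`, so the
weight at `k_ε` is `O(k_ε^(-1/2)) = O(ε^e)`. A4 extends this to the first weight, hence by
monotonicity to all. -/
theorem eventually_weight_le {κ : ℝ → ℕ → ℝ} {e : ℝ}
    (hA1 : CondA1 κ) (hA2 : CondA2 κ) (hA4 : CondA4 κ)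
    (hk : (fun ε => (kEff κ ε : ℝ)) =Θ[𝓝[>] (0 : ℝ)] fun ε => ε ^ (-(2 * e))) :
    ∃ M : ℝ, 0 < M ∧ ∀ᶠ ε in 𝓝[>] (0 : ℝ), 1 ≤ kEff κ ε ∧
      kappaSq κ ε / (ε ^ 2 * √(2 * A κ ε)) ≤ M * ε ^ e ∧ ∀ j, weight κ ε j ≤ M * ε ^ e := by
  obtain ⟨C, hC, hCk⟩ := hk.2.exists_pos
  obtain ⟨C', hC', hC'κ⟩ := hA4.1.1.exists_pos
  obtain ⟨c₁, c₂, hc₁, hA⟩ := hA2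
  refine ⟨max C 1 * max C' 1, by positivity, ?_⟩
  filter_upwards [hCk.bound, hC'κ.bound, self_mem_nhdsWithin] with ε h1 h2 hε
  have hε : 0 < ε := hε
  have hAp : 0 < A κ ε := hc₁.trans (hA ε hε).1
  have hq : 0 < ε ^ 2 * √(2 * A κ ε) := by positivity
  rw [Real.norm_of_nonneg (by positivity), Real.norm_of_nonneg (by positivity)] at h1
  rw [Real.norm_of_nonneg (by positivity),
    Real.norm_of_nonneg (by unfold kappaSq; positivity)] at h2
  have hk1 : 1 ≤ kEff κ ε := by
    rcases Nat.eq_zero_or_pos (kEff κ ε) with h0 | h0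
    · have : 0 < ε ^ (-(2 * e)) := by positivity
      rw [h0] at h1
      simp at h1
      linarith
    · exact h0
  set v := kappaSq κ ε / (ε ^ 2 * √(2 * A κ ε)) with hv
  have hv0 : 0 ≤ v := by rw [hv]; unfold kappaSq; positivity
  have hsum : kEff κ ε * v ^ 2 ≤ 1 / 2 := by
    have hle : ∀ j ∈ initialSegment (kEff κ ε), v ^ 2 ≤ weight κ ε j ^ 2 := by
      intro j hj
      have := hA1 ε hε (Set.mem_Ici.2 j.pos) (Set.mem_Ici.2 hk1) (mem_initialSegment.1 hj)
      gcongr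
      rw [hv, weight]
      gcongr
      exact this
    have h := Finset.card_nsmul_le_sum _ _ _ hle
    rw [card_initialSegment, nsmul_eq_mul] at h
    exact h.trans (sum_le_hasSum _ (fun _ _ => sq_nonneg _) (hasSum_weight_sq hε hAp))
  have hv1 : v ≤ max C 1 * ε ^ e := by
    refine le_of_sq_le_sq ?_ (by positivity)
    have hee : ε ^ (-(2 * e)) * (ε ^ e) ^ 2 = 1 := by
      rw [← Real.rpow_natCast, ← Real.rpow_mul hε.le, ← Real.rpow_add hε]
      norm_num
      rw [show -(2 * e) + e * 2 = 0 by ring, Real.rpow_zero]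
    have hee0 : 0 < ε ^ e := by positivity
    have h3 : ε ^ (-(2 * e)) * v ^ 2 ≤ C * (1 / 2) := by
      calc _ ≤ C * kEff κ ε * v ^ 2 := by gcongr
        _ ≤ _ := by rw [mul_assoc]; gcongr
    have h4 : v ^ 2 ≤ C * (1 / 2) * (ε ^ e) ^ 2 := by
      calc v ^ 2 = ε ^ (-(2 * e)) * v ^ 2 * (ε ^ e) ^ 2 := by
            rw [mul_right_comm, hee, one_mul]
        _ ≤ _ := by gcongr
    rw [mul_pow]
    refine h4.trans ?_
    gcongr
    nlinarith [le_max_left C 1, le_max_right C 1]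
  refine ⟨hk1, hv1.trans ?_, fun j => ?_⟩
  · have := le_max_right C' 1
    gcongr
    exact le_mul_of_one_le_right (by positivity) this
  · have h5 : weight κ ε j ≤ C' * v := by
      have := hA1 ε hε (Set.mem_Ici.2 le_rfl) (Set.mem_Ici.2 j.pos) j.pos
      rw [weight, hv, ← mul_div_assoc]
      gcongr
      exact le_trans this h2
    calc _ ≤ C' * v := h5
      _ ≤ max C' 1 * (max C 1 * ε ^ e) := by gcongr; exact le_max_left _ _
      _ = _ := by ring

/-- At the threshold `-2` the type I error is at least `1/2`, so consistency gives `|log β| ≥ c₀ R²`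
with `R = ε^(-2ω)`. If `B` were small compared with `R`, the lower bound on `β` would contradict
this; `2ω < e` keeps that bound applicable, since then `ε^e * R → 0`. -/
theorem eventually_le_B_of_isLDConsistent {φ : ℕ+ → L2} {κ : ℝ → ℕ → ℝ} {S : ℝ → L2}
    {e ω M : ℝ} (hφ : Orthonormal ℝ φ) (hκ : WeightsSummable κ) (hA2 : CondA2 κ) (hω : 0 < ω)
    (he : 2 * ω < e) (hM : 0 < M)
    (hw : ∀ᶠ ε in 𝓝[>] (0 : ℝ), ∀ j, weight κ ε j ≤ M * ε ^ e)
    (hcons : IsLDConsistent φ κ (fun ε => ε ^ (-2 * ω)) S) :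
    ∃ b : ℝ, 0 < b ∧ ∀ᶠ ε in 𝓝[>] (0 : ℝ), b * ε ^ (-2 * ω) ≤ B φ κ ε (S ε) := by
  obtain ⟨c₁, c₂, hc₁, hA⟩ := hA2
  have hpos : ∀ᶠ ε in 𝓝[>] (0 : ℝ), 0 < ε := self_mem_nhdsWithin
  have hlim : Tendsto (fun ε => absLog (typeI φ κ ε (-2)) /
      ENNReal.ofReal ((ε ^ (-2 * ω)) ^ 2)) (𝓝[>] 0) (𝓝 0) := by
    have h0 : Tendsto (fun ε : ℝ => ENNReal.ofReal (Real.log 2 * ε ^ (4 * ω))) (𝓝[>] 0) (𝓝 0) := by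
      rw [← ENNReal.ofReal_zero]
      refine ENNReal.tendsto_ofReal ?_
      simpa using (tendsto_rpow_nhdsGT_zero (show 0 < 4 * ω by linarith)).const_mul (Real.log 2)
    refine tendsto_of_tendsto_of_tendsto_of_le_of_le' tendsto_const_nhds h0
      (Eventually.of_forall fun _ => zero_le) ?_
    filter_upwards [hpos] with ε hε
    have h1 := half_le_typeI hφ hε (hκ ε hε) (hc₁.trans (hA ε hε).1) (le_refl (-2))
    have h2 : 1 / 2 ≤ (typeI φ κ ε (-2)).toReal := by
      have := ENNReal.toReal_mono (show typeI φ κ ε (-2) ≠ ∞ from measure_ne_top _ _) h1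
      rwa [ENNReal.toReal_div, ENNReal.toReal_one, ENNReal.toReal_ofNat] at this
    have h3 : (typeI φ κ ε (-2)).toReal ≤ 1 := measureReal_le_one
    have hR : 0 < (ε ^ (-2 * ω)) ^ 2 := by positivity
    rw [absLog_eq (by linarith), ← ENNReal.ofReal_div_of_pos hR]
    refine ENNReal.ofReal_le_ofReal ?_
    have h4 : |Real.log (typeI φ κ ε (-2)).toReal| ≤ Real.log 2 := by
      rw [abs_of_nonpos (Real.log_nonpos (by linarith) h3), neg_le, ← Real.log_inv]
      exact Real.log_le_log (by norm_num) (by linarith)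
    have h5 : ε ^ (4 * ω) = ((ε ^ (-2 * ω)) ^ 2)⁻¹ := by
      rw [← Real.rpow_natCast, ← Real.rpow_mul hε.le, ← Real.rpow_neg hε.le]
      congr 1
      push_cast
      ring
    rw [h5, div_eq_mul_inv]
    gcongr
  obtain ⟨c₀, hc₀, hcc⟩ := hcons _ hlim
  -- With `τ = 1 / 10` the factor `1/2 + 5τ` is `1`, so at level `η * R` the bound gives `|log β| ≤
  -- η² R² = c₀ R² / 4`. `R ≥ 4 / η` ensures `B + 2 ≤ η * R`, and `R ≥ 30 / η` ensures `(η * R * τ)²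
  -- ≥ 9`.
  set η := √c₀ / 2 with hη
  have hη0 : 0 < η := by positivity
  have hη2 : η ^ 2 = c₀ / 4 := by rw [hη, div_pow, Real.sq_sqrt hc₀.le]; norm_num
  have hRtop : Tendsto (fun ε : ℝ => ε ^ (-2 * ω)) (𝓝[>] 0) atTop :=
    tendsto_rpow_neg_nhdsGT_zero (by linarith)
  have hMR : Tendsto (fun ε : ℝ => 4 * M * η * ε ^ (e - 2 * ω)) (𝓝[>] 0) (𝓝 0) := by
    simpa using (tendsto_rpow_nhdsGT_zero (show 0 < e - 2 * ω by linarith)).const_mul (4 * M * η)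
  refine ⟨η / 2, by positivity, ?_⟩
  filter_upwards [hcc, hw, hpos, hRtop.eventually_ge_atTop (4 / η),
    hRtop.eventually_ge_atTop (30 / η),
    hMR.eventually (eventually_le_nhds (show (0 : ℝ) < (1 / 10) ^ 2 / 26 by norm_num))]
    with ε h1 h2 hε h3 h4 h5
  by_contra hB
  rw [not_le] at hB
  set R := ε ^ (-2 * ω) with hR
  have hRe : ε ^ (e - 2 * ω) = ε ^ e * R := by
    rw [hR, ← Real.rpow_add hε]
    congr 1
    ring
  rw [hRe] at h5
  rw [div_le_iff₀ hη0] at h3 h4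
  have hee0 : 0 < ε ^ e := by positivity
  have hlo := exp_neg_le_typeII_toReal (S := S ε) (x := -2) (y := η * R) (τ := 1 / 10) hφ hε
    (hκ ε hε) (hc₁.trans (hA ε hε).1) h2 (by norm_num) (by norm_num) (by positivity)
    (by nlinarith) (by nlinarith)
    (by
      have hle : M * ε ^ e * B φ κ ε (S ε) ≤ M * ε ^ e * (η * R) := by
        gcongr
        nlinarith
      linarith)
    (by linarith)
  have hp := (Real.exp_pos _).trans_le hlo
  have hl := (Real.le_log_iff_exp_le hp).2 hlo
  have hn := Real.log_nonpos hp.le typeII_toReal_le_one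
  rw [absLog_eq hp, ENNReal.ofReal_le_ofReal_iff (abs_nonneg _), abs_of_nonpos hn] at h1
  have hR0 : 0 < R ^ 2 := by positivity
  rw [mul_pow, hη2] at hl
  nlinarith

end Asymptotic

/-! ### Choice of the truncation level; smoothness and norm of the truncation. -/

/-- The truncation level `[(1 + d) k_ε]`. -/
noncomputable def level (κ : ℝ → ℕ → ℝ) (d ε : ℝ) : ℕ := ⌊(1 + d) * (kEff κ ε : ℝ)⌋₊

theorem eventually_B_sub_trunc_le {φ : ℕ+ → L2} {κ : ℝ → ℕ → ℝ} {S : ℝ → L2} {e r ω M b η : ℝ}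
    (hφ : Orthonormal ℝ φ) (hκ : WeightsSummable κ) (hA1 : CondA1 κ) (hA3 : CondA3 κ)
    (he : e = 2 - 4 * r - 2 * ω) (hM : 0 < M) (hb : 0 < b) (hη : 0 < η)
    (hw : ∀ᶠ ε in 𝓝[>] (0 : ℝ), 1 ≤ kEff κ ε ∧
      kappaSq κ ε / (ε ^ 2 * √(2 * A κ ε)) ≤ M * ε ^ e ∧ ∀ j, weight κ ε j ≤ M * ε ^ e)
    (hB : ∀ᶠ ε in 𝓝[>] (0 : ℝ), b * ε ^ (-2 * ω) ≤ B φ κ ε (S ε))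
    (hS : (fun ε => ‖S ε‖) =O[𝓝[>] (0 : ℝ)] fun ε => ε ^ (2 * r)) :
    ∃ d : ℝ, 0 < d ∧ ∀ᶠ ε in 𝓝[>] (0 : ℝ),
      B φ κ ε (S ε - trunc φ (level κ d ε) (S ε)) ≤ η * B φ κ ε (S ε) := by
  obtain ⟨C₁, l, hC₁, hl, hA⟩ := hA3
  obtain ⟨C, hC, hCS⟩ := hS.exists_pos
  -- The quantity is the constant in the bound for the remainder; `d` is taken so large that it
  -- drops below `η * b`, uniformly in `ε`.
  have hlim : Tendsto (fun d : ℝ => C₁ * M * C ^ 2 * (1 + d) ^ (-l)) atTop (𝓝 0) := by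
    simpa using ((tendsto_rpow_neg_atTop (show 0 < l by linarith)).comp
      (tendsto_atTop_add_const_left atTop 1 tendsto_id)).const_mul (C₁ * M * C ^ 2)
  obtain ⟨d, hd, hd0⟩ := ((hlim.eventually (eventually_le_nhds (mul_pos hη hb))).and
    (eventually_gt_atTop 0)).exists
  refine ⟨d, hd0, ?_⟩
  filter_upwards [hw, hB, hCS.bound, self_mem_nhdsWithin] with ε ⟨hk1, hv, _⟩ h2 h3 hε
  have hε : 0 < ε := hε
  rw [norm_norm, Real.norm_of_nonneg (by positivity)] at h3
  set v := kappaSq κ ε / (ε ^ 2 * √(2 * A κ ε)) with hv_def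
  set W := C₁ * (1 + d) ^ (-l) * v with hW
  have hv0 : 0 ≤ v := by rw [hv_def]; unfold kappaSq; positivity
  have hlev : 1 ≤ level κ d ε := by
    refine Nat.le_floor ?_
    have : (1 : ℝ) ≤ kEff κ ε := by exact_mod_cast hk1
    push_cast
    nlinarith
  have htail : ∀ j : ℕ+, level κ d ε < j → weight κ ε j ≤ W := by
    intro j hj
    have h4 := hA1 ε hε (Set.mem_Ici.2 hlev) (Set.mem_Ici.2 j.pos) hj.le
    have h5 := (le_trans h4 (hA d hd0 ε hε).le : κ ε j ^ 2 ≤ _)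
    rw [weight, hW, hv_def, ← mul_div_assoc]
    gcongr
  have hid : ε ^ e * (ε ^ (2 * r) / ε) ^ 2 = ε ^ (-2 * ω) := by
    rw [div_pow, ← Real.rpow_natCast, ← Real.rpow_natCast, ← Real.rpow_mul hε.le,
      ← Real.rpow_sub hε, ← Real.rpow_add hε, he]
    congr 1
    push_cast
    ring
  calc B φ κ ε (S ε - trunc φ (level κ d ε) (S ε)) ≤ W * (‖S ε‖ / ε) ^ 2 :=
        B_sub_trunc_le hφ _ _ (hκ ε hε) (by positivity) htail
    _ ≤ (C₁ * (1 + d) ^ (-l) * (M * ε ^ e)) * (C * ε ^ (2 * r) / ε) ^ 2 := by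
        rw [hW]
        gcongr
    _ = C₁ * M * C ^ 2 * (1 + d) ^ (-l) * (ε ^ e * (ε ^ (2 * r) / ε) ^ 2) := by ring
    _ ≤ η * b * ε ^ (-2 * ω) := by
        rw [hid]
        gcongr
    _ ≤ η * B φ κ ε (S ε) := by
        rw [mul_assoc]
        gcongr

theorem eventually_level_rpow_mul_norm_sq_le {κ : ℝ → ℕ → ℝ} {S : ℝ → L2} {e r d : ℝ}
    (he : 0 < e) (hr : 0 < r) (hd : 0 < d)
    (hk : (fun ε => (kEff κ ε : ℝ)) =O[𝓝[>] (0 : ℝ)] fun ε => ε ^ (-(2 * e)))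
    (hS : (fun ε => ‖S ε‖) =O[𝓝[>] (0 : ℝ)] fun ε => ε ^ (2 * r)) :
    ∃ P : ℝ, 0 < P ∧ ∀ᶠ ε in 𝓝[>] (0 : ℝ),
      (level κ d ε : ℝ) ^ (2 * (r / e)) * ‖S ε‖ ^ 2 ≤ P := by
  obtain ⟨C, hC, hCS⟩ := hS.exists_pos
  obtain ⟨K, hK, hKk⟩ := hk.exists_pos
  refine ⟨((1 + d) * K) ^ (2 * (r / e)) * C ^ 2, by positivity, ?_⟩
  filter_upwards [hCS.bound, hKk.bound, self_mem_nhdsWithin] with ε h1 h2 hε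
  have hε : 0 < ε := hε
  rw [norm_norm, Real.norm_of_nonneg (by positivity)] at h1
  rw [Real.norm_of_nonneg (by positivity), Real.norm_of_nonneg (by positivity)] at h2
  have h3 : (level κ d ε : ℝ) ≤ (1 + d) * K * ε ^ (-(2 * e)) := by
    refine (Nat.floor_le (by positivity)).trans ?_
    rw [mul_assoc]
    gcongr
  calc (level κ d ε : ℝ) ^ (2 * (r / e)) * ‖S ε‖ ^ 2
      ≤ ((1 + d) * K * ε ^ (-(2 * e))) ^ (2 * (r / e)) * (C * ε ^ (2 * r)) ^ 2 := by gcongr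
    _ = ((1 + d) * K) ^ (2 * (r / e)) * C ^ 2 *
          ((ε ^ (-(2 * e))) ^ (2 * (r / e)) * (ε ^ (2 * r)) ^ 2) := by
        rw [Real.mul_rpow (by positivity) (by positivity)]
        ring
    _ = _ := by
        rw [← Real.rpow_natCast (ε ^ (2 * r)), ← Real.rpow_mul hε.le, ← Real.rpow_mul hε.le,
          ← Real.rpow_add hε]
        have : -(2 * e) * (2 * (r / e)) + 2 * r * ((2 : ℕ) : ℝ) = 0 := by
          field_simp
          push_cast
          ring
        rw [this, Real.rpow_zero, mul_one]

/-- The truncation keeps at least half of `B(S) ≥ b ε^(-2ω)`, whereas its `B` is at most `M ε^e (N /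
ε)²` for its norm `N`; since `e - 2 + 4r = -2ω`, this forces `N` to be at least of order `ε^(2r)`.
-/
theorem isBigO_norm_trunc {φ : ℕ+ → L2} {κ : ℝ → ℕ → ℝ} {S : ℝ → L2} {e r ω M b η : ℝ}
    {n : ℝ → ℕ}
    (hφ : Orthonormal ℝ φ) (hκ : WeightsSummable κ)
    (he : e = 2 - 4 * r - 2 * ω) (hM : 0 < M) (hb : 0 < b) (hη : η ≤ 1 / 2)
    (hw : ∀ᶠ ε in 𝓝[>] (0 : ℝ), ∀ j, weight κ ε j ≤ M * ε ^ e)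
    (hB : ∀ᶠ ε in 𝓝[>] (0 : ℝ), b * ε ^ (-2 * ω) ≤ B φ κ ε (S ε))
    (hBt : ∀ᶠ ε in 𝓝[>] (0 : ℝ),
      B φ κ ε (S ε - trunc φ (n ε) (S ε)) ≤ η * B φ κ ε (S ε)) :
    (fun ε => ε ^ (2 * r)) =O[𝓝[>] (0 : ℝ)] fun ε => ‖trunc φ (n ε) (S ε)‖ := by
  refine IsBigO.of_bound √(2 * M / b) ?_
  filter_upwards [hw, hB, hBt, self_mem_nhdsWithin] with ε h1 h2 h3 hε
  have hε : 0 < ε := hε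
  have h4 := B_eq_B_trunc_add hφ (n ε) (S ε) (hκ ε hε)
  have h5 := B_le hφ (trunc φ (n ε) (S ε)) (hκ ε hε) h1
  have h6 : η * B φ κ ε (S ε) ≤ 1 / 2 * B φ κ ε (S ε) :=
    mul_le_mul_of_nonneg_right hη (B_nonneg ..)
  set N := ‖trunc φ (n ε) (S ε)‖ with hN
  have hid : ε ^ (-2 * ω) = ε ^ e / ε ^ 2 * (ε ^ (2 * r)) ^ 2 := by
    rw [← Real.rpow_natCast, ← Real.rpow_natCast, ← Real.rpow_mul hε.le,
      ← Real.rpow_sub hε, ← Real.rpow_add hε, he]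
    congr 1
    push_cast
    ring
  rw [norm_norm, Real.norm_of_nonneg (by positivity)]
  refine le_of_sq_le_sq ?_ (by positivity)
  rw [mul_pow, Real.sq_sqrt (by positivity)]
  have hp : 0 < ε ^ e / ε ^ 2 := by positivity
  have h7 : ε ^ e / ε ^ 2 * (b * (ε ^ (2 * r)) ^ 2) ≤ ε ^ e / ε ^ 2 * (2 * M * N ^ 2) := by
    calc _ = b * ε ^ (-2 * ω) := by rw [hid]; ring
      _ ≤ 2 * (M * ε ^ e * (N / ε) ^ 2) := by linarith
      _ = _ := by rw [div_pow]; ring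
  have h8 := le_of_mul_le_mul_left h7 hp
  rw [div_mul_eq_mul_div, le_div_iff₀ hb]
  linarith

/-! ### Consequences of admissibility of the thresholds. -/

theorem AdmissibleTests.eventually_neg_two_le {φ : ℕ+ → L2} {κ : ℝ → ℕ → ℝ} {S : ℝ → L2} {c : ℝ}
    {x : ℝ → ℝ} (h : AdmissibleTests φ κ c S x) (hφ : Orthonormal ℝ φ) (hκ : WeightsSummable κ)
    (hA2 : CondA2 κ) : ∀ᶠ ε in 𝓝[>] (0 : ℝ), -2 ≤ x ε := by
  obtain ⟨c₁, c₂, hc₁, hA⟩ := hA2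
  filter_upwards [h.1.eventually (eventually_lt_nhds (show (0 : ℝ≥0∞) < 1 / 2 by simp)),
    self_mem_nhdsWithin] with ε h1 hε
  by_contra hx
  exact absurd h1 (half_le_typeI hφ hε (hκ ε hε) (hc₁.trans (hA ε hε).1) (not_le.1 hx).le).not_gt

theorem AdmissibleTests.tendsto_B {φ : ℕ+ → L2} {κ : ℝ → ℕ → ℝ} {S : ℝ → L2} {c : ℝ}
    {x : ℝ → ℝ} (h : AdmissibleTests φ κ c S x) (hA2 : CondA2 κ) :
    Tendsto (fun ε => B φ κ ε (S ε)) (𝓝[>] 0) atTop := by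
  obtain ⟨c₁, c₂, hc₁, hA⟩ := hA2
  have hc₂ : 0 < c₂ := (hc₁.trans (hA 1 one_pos).1).trans (hA 1 one_pos).2
  refine tendsto_atTop_mono' _ ?_ (h.2.1.atTop_div_const (show 0 < √(2 * c₂) by positivity))
  filter_upwards [h.2.1.eventually_ge_atTop 0, self_mem_nhdsWithin] with ε h1 hε
  have h2 := hA ε hε
  have hAp : 0 < A κ ε := hc₁.trans h2.1
  rw [B]
  gcongr
  exact h2.2.le

/-- The role of `D_ε = o(k_ε^{1/2})`: the largest weight times `B` tends to `0`, which is the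
Gaussian regime of the tail bounds. -/
theorem AdmissibleTests.tendsto_rpow_mul_B {φ : ℕ+ → L2} {κ : ℝ → ℕ → ℝ} {S : ℝ → L2} {c e : ℝ}
    {x : ℝ → ℝ} (h : AdmissibleTests φ κ c S x) (hA2 : CondA2 κ)
    (hk : (fun ε => (kEff κ ε : ℝ)) =O[𝓝[>] (0 : ℝ)] fun ε => ε ^ (-(2 * e))) :
    Tendsto (fun ε => ε ^ e * B φ κ ε (S ε)) (𝓝[>] 0) (𝓝 0) := by
  have hpos : ∀ᶠ ε in 𝓝[>] (0 : ℝ), 0 < ε := self_mem_nhdsWithin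
  obtain ⟨c₁, c₂, hc₁, hA⟩ := hA2
  have hB : (fun ε => B φ κ ε (S ε)) =O[𝓝[>] (0 : ℝ)] fun ε => D φ κ ε (S ε) := by
    refine IsBigO.of_bound (√(2 * c₁))⁻¹ ?_
    filter_upwards [hpos] with ε hε
    have h2 := hA ε hε
    rw [B, norm_div, mul_comm (√(2 * c₁))⁻¹, ← div_eq_mul_inv, Real.norm_of_nonneg (Real.sqrt_nonneg _)]
    gcongr
    exact h2.1.le
  have hsqrt : (fun ε => √(kEff κ ε : ℝ)) =O[𝓝[>] (0 : ℝ)] fun ε => ε ^ (-e) := by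
    have h1 := hk.rpow (r := 1 / 2) (by norm_num)
      (by filter_upwards [hpos] with ε hε; positivity)
    refine (h1.congr_left fun ε => (Real.sqrt_eq_rpow _).symm).trans_eventuallyEq ?_
    filter_upwards [hpos] with ε hε
    rw [← Real.rpow_mul hε.le]
    congr 1
    ring
  have h1 : (fun ε => ε ^ e * B φ κ ε (S ε)) =o[𝓝[>] (0 : ℝ)] fun _ => (1 : ℝ) := by
    refine ((isBigO_refl (fun ε : ℝ => ε ^ e) _).mul_isLittleO
      ((hB.trans_isLittleO h.2.2.1).trans_isBigO hsqrt)).trans_eventuallyEq ?_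
    filter_upwards [hpos] with ε hε
    rw [← Real.rpow_add hε, add_neg_cancel, Real.rpow_zero]
  exact (isLittleO_one_iff ℝ).1 h1

theorem AdmissibleTests.eventually_comparison {φ : ℕ+ → L2} {κ : ℝ → ℕ → ℝ} {S : ℝ → L2}
    {n : ℝ → ℕ} {c e M η ρ τ δ : ℝ} {x : ℝ → ℝ} (h : AdmissibleTests φ κ c S x)
    (hφ : Orthonormal ℝ φ) (hκ : WeightsSummable κ) (hA2 : CondA2 κ)
    (hk : (fun ε => (kEff κ ε : ℝ)) =O[𝓝[>] (0 : ℝ)] fun ε => ε ^ (-(2 * e)))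
    (hw : ∀ᶠ ε in 𝓝[>] (0 : ℝ), ∀ j, weight κ ε j ≤ M * ε ^ e)
    (hBt : ∀ᶠ ε in 𝓝[>] (0 : ℝ),
      B φ κ ε (S ε - trunc φ (n ε) (S ε)) ≤ η * B φ κ ε (S ε))
    (hηρ : η ≤ ρ * c) (hc : 0 < c) (hτ : 0 < τ) (hτ2 : τ ≤ 1 / 2) (hρ : 0 < ρ) (hρ1 : ρ ≤ 1 / 4)
    (hδ : 6 * τ + ρ ≤ δ / 4) (hδ2 : 16 * ρ ≤ δ / 4) :
    ∀ᶠ ε in 𝓝[>] (0 : ℝ),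
      (ENNReal.log (typeII φ κ ε (x ε) (S ε)) -
          ENNReal.log (typeII φ κ ε (x ε) (trunc φ (n ε) (S ε)))).abs ≤
        ENNReal.ofReal δ * absLog (typeII φ κ ε (x ε) (S ε)) ∧
      absLog (typeII φ κ ε (x ε) (S ε - trunc φ (n ε) (S ε))) ≤
        ENNReal.ofReal δ * absLog (typeII φ κ ε (x ε) (S ε)) := by
  have hlim : Tendsto (fun ε => 8 * M * (ε ^ e * B φ κ ε (S ε))) (𝓝[>] 0) (𝓝 0) := by
    simpa using (h.tendsto_rpow_mul_B hA2 hk).const_mul (8 * M)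
  have htop := h.tendsto_B hA2
  have hx2 := h.eventually_neg_two_le hφ hκ hA2
  obtain ⟨c₁, c₂, hc₁, hA⟩ := hA2
  have hρc : 0 < ρ * c := mul_pos hρ hc
  filter_upwards [hw, hBt, h.2.2.2, hx2, htop.eventually_ge_atTop 2,
    htop.eventually_ge_atTop (2 / (ρ * c)), htop.eventually_ge_atTop (3 / (2 * (ρ * c) * τ)),
    hlim.eventually (eventually_le_nhds (show 0 < τ ^ 2 / 26 by positivity)),
    self_mem_nhdsWithin] with ε h1 h2 h3 h4 h5 h6 h7 h8 hε
  have hε : 0 < ε := hε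
  rw [div_le_iff₀ (by positivity)] at h6 h7
  refine typeII_comparison hφ hε (hκ ε hε) (hc₁.trans (hA ε hε).1) h1
    (B_eq_B_trunc_add hφ (n ε) (S ε) (hκ ε hε)) h2 hηρ hc h3 h4 h5 (by linarith) ?_ (by linarith)
    hτ hτ2 hρ hρ1 hδ hδ2
  nlinarith

end QuadTest

/-! ### Assembly of the theorem. -/

theorem mainTheorem7
    (φ : ℕ+ → QuadTest.L2) (hφ : Orthonormal ℝ φ)
    (κ : ℝ → ℕ → ℝ) (hκ : QuadTest.WeightsSummable κ)
    (hA1 : QuadTest.CondA1 κ) (hA2 : QuadTest.CondA2 κ)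
    (hA3 : QuadTest.CondA3 κ) (hA4 : QuadTest.CondA4 κ)
    (r ω : ℝ) (hr₀ : 0 < r) (hr : r < 1 / 2) (hω₀ : 0 < ω) (hω : 2 * ω < 1 - 2 * r)
    (hk : (fun ε => (QuadTest.kEff κ ε : ℝ)) =Θ[𝓝[>] (0 : ℝ)]
      fun ε => ε ^ (-4 + 8 * r + 4 * ω))
    (δ : ℝ) (hδ : 0 < δ) (c : ℝ) (hc : 0 < c)
    (S : ℝ → QuadTest.L2)
    (hS : (fun ε => ‖S ε‖) =Θ[𝓝[>] (0 : ℝ)] fun ε => ε ^ (2 * r))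
    (hcons : QuadTest.IsLDConsistent φ κ (fun ε => ε ^ (-2 * ω)) S) :
    ∃ P₀ : ℝ, 0 < P₀ ∧ ∃ S₁ : ℝ → QuadTest.L2,
      (∀ ε : ℝ, 0 < ε →
        S₁ ε ∈ QuadTest.besovBall φ (r / (2 - 4 * r - 2 * ω)) P₀) ∧
      ((fun ε => ‖S₁ ε‖) =Θ[𝓝[>] (0 : ℝ)] fun ε => ε ^ (2 * r)) ∧
      (∀ ε : ℝ, 0 < ε → inner ℝ (S₁ ε) (S ε - S₁ ε) = 0) ∧
      ∀ x : ℝ → ℝ, QuadTest.AdmissibleTests φ κ c S x →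
        ∃ ε₀ : ℝ, 0 < ε₀ ∧ ∀ ε : ℝ, 0 < ε → ε < ε₀ →
          (ENNReal.log (QuadTest.typeII φ κ ε (x ε) (S ε)) -
              ENNReal.log (QuadTest.typeII φ κ ε (x ε) (S₁ ε))).abs ≤
            ENNReal.ofReal δ * QuadTest.absLog (QuadTest.typeII φ κ ε (x ε) (S ε)) ∧
          QuadTest.absLog (QuadTest.typeII φ κ ε (x ε) (S ε - S₁ ε)) ≤
            ENNReal.ofReal δ * QuadTest.absLog (QuadTest.typeII φ κ ε (x ε) (S ε)) := by
  obtain ⟨e, he⟩ : ∃ e, e = 2 - 4 * r - 2 * ω := ⟨_, rfl⟩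
  have he0 : 0 < e := by linarith
  rw [show -4 + 8 * r + 4 * ω = -(2 * e) by rw [he]; ring] at hk
  rw [← he]
  obtain ⟨M, hM, hMw⟩ := QuadTest.eventually_weight_le hA1 hA2 hA4 hk
  have hw := hMw.mono fun ε h => h.2.2
  obtain ⟨b, hb, hB⟩ := QuadTest.eventually_le_B_of_isLDConsistent hφ hκ hA2 hω₀
    (show 2 * ω < e by linarith) hM hw hcons
  set ρ := min (1 / 4) (δ / 64) with hρ
  set τ := min (1 / 2) (δ / 48) with hτ
  have hρ0 : 0 < ρ := by positivity
  have hτ0 : 0 < τ := by positivity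
  have hρδ : ρ ≤ δ / 64 := min_le_right _ _
  have hτδ : τ ≤ δ / 48 := min_le_right _ _
  -- The bound `ρ * c` serves the comparison of errors, the bound `1 / 2` the lower estimate of the
  -- norm of the truncation.
  set η := min (ρ * c) (1 / 2) with hη
  have hη0 : 0 < η := by positivity
  obtain ⟨d, hd, hBt⟩ := QuadTest.eventually_B_sub_trunc_le hφ hκ hA1 hA3 he hM hb hη0 hMw hB hS.1
  obtain ⟨P, hP, hPl⟩ := QuadTest.eventually_level_rpow_mul_norm_sq_le he0 hr₀ hd hk.1 hS.1
  obtain ⟨ε₁, hε₁, hPε⟩ := mem_nhdsGT_iff_exists_Ioo_subset.1 hPl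
  -- The Besov bound for the truncation is available only for small `ε`, but membership is required
  -- for every `ε > 0`; the value `0` settles the others. The choice is made before any thresholds
  -- are given.
  set S₁ : ℝ → QuadTest.L2 := fun ε =>
    if ε < ε₁ then QuadTest.trunc φ (QuadTest.level κ d ε) (S ε) else 0 with hS₁
  have hev : ∀ᶠ ε in 𝓝[>] (0 : ℝ),
      S₁ ε = QuadTest.trunc φ (QuadTest.level κ d ε) (S ε) := by
    filter_upwards [Ioo_mem_nhdsGT hε₁] with ε hε
    exact if_pos hε.2
  refine ⟨P, hP, S₁, fun ε hε => ?_, ⟨?_, ?_⟩, fun ε _ => ?_, fun x hx => ?_⟩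
  · by_cases h : ε < ε₁
    · rw [hS₁]
      simp only [if_pos h]
      exact QuadTest.trunc_mem_besovBall hφ _ _ (by positivity) (hPε ⟨hε, h⟩)
    · rw [hS₁]
      simp only [if_neg h]
      refine ⟨fun _ => 0, by simp [hasSum_zero], fun t _ => ?_⟩
      simpa using hP.le
  · refine IsBigO.trans (IsBigO.of_bound' ?_) hS.1
    filter_upwards [hev] with ε h
    rw [norm_norm, norm_norm, h]
    exact QuadTest.norm_trunc_le hφ _ _
  · refine (QuadTest.isBigO_norm_trunc hφ hκ he hM hb (min_le_right _ _) hw hB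
      hBt).trans_eventuallyEq ?_
    filter_upwards [hev] with ε h
    rw [h]
  · by_cases h : ε < ε₁
    · rw [hS₁]
      simp only [if_pos h]
      exact QuadTest.inner_trunc_sub_trunc hφ _ _
    · rw [hS₁]
      simp only [if_neg h]
      exact inner_zero_left _
  · have hcmp := QuadTest.AdmissibleTests.eventually_comparison (δ := δ) hx hφ hκ hA2 hk.1 hw hBt
      (min_le_left _ _) hc hτ0 (min_le_left _ _) hρ0 (min_le_left _ _) (by linarith) (by linarith)
    have hcmp₁ := hcmp.and hev
    obtain ⟨ε₀, hε₀, hsub⟩ := mem_nhdsGT_iff_exists_Ioo_subset.1 hcmp₁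
    refine ⟨ε₀, hε₀, fun ε h0 h1 => ?_⟩
    obtain ⟨h2, h3⟩ := hsub ⟨h0, h1⟩
    rw [h3]
    exact h2
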